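/- **Theorem (convolution in $x$ of weak solutions).** Let $\Omega\subset\mathbb{R}^N$ be a bounded open set (in particular, a bounded domain), let $T>0$, $p\in(1,\infty]$, let $q$ be the conjugate exponent, $\frac1p+\frac1q=1$, and let $\alpha\in[q,\infty]$. Let $u\in L^1(0,T;W^{1,\alpha}(\Omega)^N)$ satisfy $\nabla\cdot u=0$ weakly, i.e. for a.e. $t\in(0,T)$, $\int_\Omega u(t)\cdot\nabla\psi\,dx=0$ for all $\psi\in C_c^\infty(\Omega)$. Let $\rho_0\in L^p(\Omega)$ and let $\rho\in L^\infty(0,T;L^p(\Omega))$ be a weak solution of $\rho_t-u\cdot\nabla\rho=0$, $\rho(0)=\rho_0$, i.e. $$-\int_0^T\!\!\int_\Omega\rho\,\partial_t\phi\,dx\,dt-\int_\Omega\rho_0\,\phi(0,\cdot)\,dx+\int_0^T\!\!\int_\Omega\rho\,u\cdot\nabla\phi\,dx\,dt=0\qquad\text{for all }\phi\in C_c^\infty([0,T)\times\Omega).$$ Let $\eta\in C_c^\infty(\mathbb{R}^N)$ be a kernel with $\eta\ge0$ and $\operatorname{supp}\eta\subset \overline{B}(0,1)$, and for $\varepsilon>0$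 put $\eta_\varepsilon(x)=\varepsilon^{-N}\eta(x/\varepsilon)$, $\Omega_\varepsilon=\{x\in\Omega:\operatorname{dist}(x,\partial\Omega)>\varepsilon\}$, $$\rho_\varepsilon(t,x)=\int_\Omega\rho(t,y)\eta_\varepsilon(x-y)\,dy,\qquad \rho^0_\varepsilon(x)=\int_\Omega\rho_0(y)\eta_\varepsilon(x-y)\,dy,$$ $$r_\varepsilon(t,x)=\int_\Omega\rho(t,y)\,\big(u(t,y)-u(t,x)\big)\cdot\nabla_x\big[\eta_\varepsilon(x-y)\big]\,dy .$$ 1. Let $\phi\in C_c^\infty([0,T)\times\Omega)$ and let $\Omega_0\subset\Omega$ be compact with $\phi(t,x)=0$ for all $t\in[0,T)$ and $x\notin\Omega_0$. If $0<\varepsilon<\operatorname{dist}(\Omega_0,\partial\Omega)$, then $$-\int_0^T\!\!\int_{\Omega_\varepsilon}\rho_\varepsilon\,\partial_t\phi\,dx\,dt-\int_{\Omega_\varepsilon}\rho^0_\varepsilon\,\phi(0,\cdot)\,dx+\int_0^T\!\!\int_{\Omega_\varepsilon}\rho_\varepsilon\,u\cdot\nabla\phi\,dx\,dt=\int_0^T\!\!\int_\Omega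 r_\varepsilon\,\phi\,dx\,dt,$$ all the integrands being integrable. 2. For every $\varepsilon>0$ the function $r_\varepsilon$ is measurable on $(0,T)\times\Omega$ (up to a null set). Let $\gamma\in[1,\infty)$ be given by $\frac1\gamma=\frac1\alpha+\frac1p$; if $\alpha=p=\infty$, let $\gamma\in[1,\infty)$ be arbitrary instead. Then $$\int_0^T\|r_\varepsilon(t)\|_{L^\gamma(\Omega_0)}\,dt\longrightarrow0\qquad\text{as }\varepsilon\to0^+$$ for every compact $\Omega_0\subset\Omega$ and, if $\Omega$ has smooth ($C^\infty$) boundary, for every subset $\Omega_0\subseteq\Omega$. -/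

import Mathlib

open MeasureTheory Set Filter Topology TopologicalSpace
open scoped ENNReal ContDiff Distributions

noncomputable section

namespace Transport

/-- The Euclidean space of dimension `N`. -/
abbrev Space (N : ℕ) : Type := EuclideanSpace ℝ (Fin N)

/-- The measure `dt ⊗ dx` on `(0,T) × A`. -/
def cylMeasure {N : ℕ} (T : ℝ) (A : Set (Space N)) : Measure (ℝ × Space N) :=
  (volume.restrict (Ioo 0 T)).prod (volume.restrict A)

/-- `f ∈ L^∞(0,T;L^p(Ω))`, for a scalar function `f = f(t,x)`. -/
def MemLinftyLp {N : ℕ} (T : ℝ) (Ω : Set (Space N)) (p : ℝ≥0∞) (f : ℝ → Space N → ℝ) : Prop :=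
  AEStronglyMeasurable (Function.uncurry f) (cylMeasure T Ω) ∧
    essSup (fun t => eLpNorm (f t) p (volume.restrict Ω)) (volume.restrict (Ioo 0 T)) < ⊤

/-- `G` is the weak (Sobolev) derivative of the vector field `v` on `Ω`: for every test function
`ψ ∈ C_c^∞(Ω)` and every direction `e`, `∫_Ω (∂_e ψ) v dx = - ∫_Ω ψ (G e) dx`. -/
def IsWeakDeriv {N : ℕ} (Ω : Opens (Space N)) (v : Space N → Space N)
    (G : Space N → (Space N →L[ℝ] Space N)) : Prop :=
  ∀ (ψ : 𝓓(Ω, ℝ)) (e : Space N),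
    ∫ x in (Ω : Set (Space N)), (fderiv ℝ (⇑ψ) x e) • v x =
      - ∫ x in (Ω : Set (Space N)), ψ x • G x e

/-- `u ∈ L^1(0,T;W^{1,α}(Ω))`, for a vector field `u = u(t,x)`: for almost every `t` the field
`u(t)` has a weak derivative `G(t)`, and `∫_0^T (‖u(t)‖_α + ‖G(t)‖_α) dt` is finite. -/
def MemL1W1 {N : ℕ} (T : ℝ) (Ω : Opens (Space N)) (α : ℝ≥0∞)
    (u : ℝ → Space N → Space N) : Prop :=
  AEStronglyMeasurable (Function.uncurry u) (cylMeasure T Ω) ∧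
    ∃ G : ℝ → Space N → (Space N →L[ℝ] Space N),
      AEStronglyMeasurable (Function.uncurry G) (cylMeasure T Ω) ∧
      (∀ᵐ t ∂(volume.restrict (Ioo 0 T)), IsWeakDeriv Ω (u t) (G t)) ∧
      ∫⁻ t in Ioo 0 T, (eLpNorm (u t) α (volume.restrict (Ω : Set (Space N))) +
        eLpNorm (G t) α (volume.restrict (Ω : Set (Space N)))) < ⊤

/-- `∇ · v = 0` in `Ω` in the weak sense: `∫_Ω v · ∇ψ dx = 0` for all `ψ ∈ C_c^∞(Ω)`. -/
def IsDivFree {N : ℕ} (Ω : Opens (Space N)) (v : Space N → Space N) : Prop :=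
  ∀ ψ : 𝓓(Ω, ℝ), ∫ x in (Ω : Set (Space N)), fderiv ℝ (⇑ψ) x (v x) = 0

/-- The open set `(-∞,T) × Ω`. The restrictions to `[0,T) × Ω` of its test functions are exactly
the elements of `C_c^∞([0,T) × Ω)`, the functions that are smooth up to the time `t = 0` and
have compact support in `[0,T) × Ω` (they need not vanish at `t = 0`). -/
def timeSpace {N : ℕ} (T : ℝ) (Ω : Opens (Space N)) : Opens (ℝ × Space N) :=
  ⟨Iio T ×ˢ (Ω : Set (Space N)), isOpen_Iio.prod Ω.isOpen⟩

/-- The time derivative `∂φ/∂t (t,x)`. -/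
def timeDeriv {N : ℕ} (φ : ℝ × Space N → ℝ) (t : ℝ) (x : Space N) : ℝ :=
  deriv (fun s => φ (s, x)) t

/-- The directional derivative `w · ∇φ(t,x)`, the gradient being taken in `x`. -/
def spaceDeriv {N : ℕ} (φ : ℝ × Space N → ℝ) (t : ℝ) (x w : Space N) : ℝ :=
  fderiv ℝ (fun z => φ (t, z)) x w

/-- The left-hand side of the weak transport equation on `A`, for the density `ρ`, the initial
density `ρ₀`, the velocity field `u` and the test function `φ`:
`- ∫_0^T ∫_A ρ ∂_t φ dx dt - ∫_A ρ₀ φ(0,·) dx + ∫_0^T ∫_A ρ (u · ∇φ) dx dt`. -/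
def weakForm {N : ℕ} (T : ℝ) (A : Set (Space N)) (u : ℝ → Space N → Space N)
    (ρ : ℝ → Space N → ℝ) (ρ₀ : Space N → ℝ) (φ : ℝ × Space N → ℝ) : ℝ :=
  - (∫ t in Ioo 0 T, ∫ x in A, ρ t x * timeDeriv φ t x)
    - (∫ x in A, ρ₀ x * φ (0, x))
    + ∫ t in Ioo 0 T, ∫ x in A, ρ t x * spaceDeriv φ t x (u t x)

/-- `ρ` satisfies the weak (distributional) form of `ρ_t - u · ∇ρ = 0` in `(0,T) × Ω`,
`ρ(0) = ρ₀`. -/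
def IsWeakSolution {N : ℕ} (T : ℝ) (Ω : Opens (Space N)) (u : ℝ → Space N → Space N)
    (ρ : ℝ → Space N → ℝ) (ρ₀ : Space N → ℝ) : Prop :=
  ∀ φ : 𝓓(timeSpace T Ω, ℝ), weakForm T Ω u ρ ρ₀ φ = 0

/-- The rescaled kernel `η_ε(x) = ε^{-N} η(x/ε)`. -/
def kernel {N : ℕ} (η : Space N → ℝ) (ε : ℝ) (x : Space N) : ℝ :=
  ε⁻¹ ^ N * η (ε⁻¹ • x)

/-- The convolution `f * η_ε` of a function `f` on `Ω`:
`(f * η_ε)(x) = ∫_Ω f(y) η_ε(x - y) dy`. -/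
def mollify {N : ℕ} (Ω : Set (Space N)) (η : Space N → ℝ) (ε : ℝ) (f : Space N → ℝ)
    (x : Space N) : ℝ :=
  ∫ y in Ω, f y * kernel η ε (x - y)

/-- The commutator error
`r_ε(t,x) = ∫_Ω ρ(t,y) (u(t,y) - u(t,x)) · ∇_x [η_ε(x - y)] dy`. -/
def commutator {N : ℕ} (Ω : Set (Space N)) (η : Space N → ℝ) (u : ℝ → Space N → Space N)
    (ρ : ℝ → Space N → ℝ) (ε : ℝ) (t : ℝ) (x : Space N) : ℝ :=
  ∫ y in Ω, ρ t y * fderiv ℝ (fun z => kernel η ε (z - y)) x (u t y - u t x)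

/-- `Ω_ε = {x ∈ Ω : dist(x, ∂Ω) > ε}`. -/
def innerSet {N : ℕ} (Ω : Set (Space N)) (ε : ℝ) : Set (Space N) :=
  {x | x ∈ Ω ∧ ENNReal.ofReal ε < Metric.infEDist x (frontier Ω)}

/-- The distance `dist(A,B) = inf {dist(a,b) : a ∈ A, b ∈ B}` of two sets. -/
def setDist {N : ℕ} (A B : Set (Space N)) : ℝ≥0∞ :=
  ⨅ a ∈ A, Metric.infEDist a B

/-- `Ω` has smooth boundary: near each boundary point `Ω` is the set where a smooth function with
nonvanishing differential at that point is negative. -/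
def HasSmoothBoundary {N : ℕ} (Ω : Set (Space N)) : Prop :=
  ∀ x₀ ∈ frontier Ω, ∃ U : Set (Space N), IsOpen U ∧ x₀ ∈ U ∧
    ∃ f : Space N → ℝ, ContDiffOn ℝ ∞ f U ∧ f x₀ = 0 ∧ fderiv ℝ f x₀ ≠ 0 ∧
      ∀ x ∈ U, (x ∈ Ω ↔ f x < 0)

end Transport

end

/-! The equation for `ρ_ε` comes from duality. Testing the equation for `ρ` with the adjoint
convolution `dualMollify` of a test function moves the mollification onto `ρ` by Fubini, except in
the transport term. There `r_ε` appears: it is the convolution of the flux `ρ u` with `∇η_ε`, minus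
`u · ∇ρ_ε`, and since `u` is divergence-free the latter can be integrated by parts against the test
function (`integral_mul_fderiv_dualMollify`).

The convergence is the DiPerna–Lions commutator argument. At a fixed time the substitution `y = x -
ε z` gives `r_ε(x) = ∫ ρ(x - ε z) ∇η(z) · (u(x - ε z) - u(x)) / ε dz`. The difference quotient is an
average of the weak derivative `G` of `u` along a segment (`IsWeakDeriv.ae_sub_eq_integral`), so
formally `r_ε` tends to `-ρ ∫ ∇η(z) · G z dz = ρ tr G ∫ η`, which is zero because `tr G` is the
divergence of `u` (`integral_fderiv_apply_linear`, `IsWeakDeriv.ae_trace_eq_zero`). Subtracting this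
vanishing limit leaves averages of `ρ(x + h) G(x + k) - ρ(x) G(x)` with `h`, `k` of order `ε`, and
these tend to zero in `L^γ` by continuity of translations (`tendsto_eLpNorm_translate_smul_sub`).

Near the boundary the segment from `x` to `x - ε z` may leave `Ω`. It is replaced by a detour
through `x + ε ν` and `x + ε ν - ε z` with `ν` pointing inward (`HasInwardShift`,
`segment_difference`). A smooth boundary provides such a `ν` near each of its points
(`exists_hasInwardShift_of_mem_frontier`); near interior points `ν = 0` will do. If `x - ε z` lies
outside `Ω`, the density extended by zero vanishes there and the last leg of the detour is not
needed. Dominated convergence in time and a covering argument finish the proof. -/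

noncomputable section

namespace Transport

/-! ### Continuity of translations in Lebesgue spaces, for functions and for products. -/

section

variable {N : ℕ} {F : Type*} [NormedAddCommGroup F]

/-- Continuity of translations in `L^p`, `p < ∞`. -/
theorem tendsto_eLpNorm_translate_sub {p : ℝ≥0∞} (hp1 : 1 ≤ p) (hp : p ≠ ⊤)
    {f : Space N → F} (hf : MemLp f p volume) :
    Tendsto (fun h => eLpNorm (fun x => f (x + h) - f x) p volume) (𝓝 0) (𝓝 0) := by
  have : Fact (1 ≤ p) := ⟨hp1⟩
  let g : Space N → C(Space N, Space N) := fun h => ⟨fun x => x + h, by fun_prop⟩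
  have hg : Continuous g := ContinuousMap.continuous_of_continuous_uncurry _ (by
    change Continuous (fun z : Space N × Space N => z.2 + z.1)
    fun_prop)
  have hgm : ∀ h, MeasurePreserving (g h) volume volume :=
    fun h => measurePreserving_add_right volume h
  have hc : Continuous fun h => Lp.compMeasurePreserving (g h) (hgm h) (hf.toLp f) :=
    continuous_const.compMeasurePreservingLp hg hgm hp
  have h0 := tendsto_iff_edist_tendsto_0.1 (hc.tendsto 0)
  refine h0.congr fun h => ?_
  rw [Lp.toLp_compMeasurePreserving hf, Lp.toLp_compMeasurePreserving hf, Lp.edist_toLp_toLp]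
  congr 1
  ext x
  simp [g]

/-- Translations preserve `L^p` norms. -/
theorem eLpNorm_translate {p : ℝ≥0∞} {f : Space N → F} (hf : AEStronglyMeasurable f volume)
    (h : Space N) : eLpNorm (fun x => f (x + h)) p volume = eLpNorm f p volume :=
  eLpNorm_comp_measurePreserving hf (measurePreserving_add_right volume h)

theorem MemLp.translate {p : ℝ≥0∞} {f : Space N → F} (hf : MemLp f p volume)
    (h : Space N) : MemLp (fun x => f (x + h)) p volume :=
  hf.comp_measurePreserving (measurePreserving_add_right volume h)

variable [NormedSpace ℝ F]

/-- The product of a translate of `f ∈ L^p` with a translate of `G ∈ L^α` is bounded in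
`L^γ`, where `1/γ = 1/α + 1/p`. -/
theorem eLpNorm_translate_smul_sub_le {p α γ : ℝ≥0∞} [ENNReal.HolderTriple p α γ] (hγ : 1 ≤ γ)
    {f : Space N → ℝ} {G : Space N → F}
    (hf : MemLp f p volume) (hG : MemLp G α volume) (h k : Space N) :
    eLpNorm (fun x => f (x + h) • G (x + k) - f x • G x) γ volume ≤
      2 * (eLpNorm f p volume * eLpNorm G α volume) := by
  have hfh := MemLp.translate hf h
  have hGk := MemLp.translate hG k
  calc _ ≤ eLpNorm ((fun x => f (x + h)) • (fun x => G (x + k))) γ volume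
        + eLpNorm (f • G) γ volume :=
        eLpNorm_sub_le (hfh.1.smul hGk.1) (hf.1.smul hG.1) hγ
    _ ≤ eLpNorm (fun x => f (x + h)) p volume * eLpNorm (fun x => G (x + k)) α volume +
          eLpNorm f p volume * eLpNorm G α volume :=
        add_le_add (eLpNorm_smul_le_mul_eLpNorm hGk.1 hfh.1)
          (eLpNorm_smul_le_mul_eLpNorm hG.1 hf.1)
    _ = _ := by
        rw [eLpNorm_translate hf.1, eLpNorm_translate hG.1, two_mul]

/-- If `f ∈ L^∞ ∩ L^γ` and `G ∈ L^γ`, then `(f(· + h) - f) G → 0` in `L^γ`. -/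
theorem tendsto_eLpNorm_translate_sub_smul_top {γ : ℝ≥0∞} (hγ : 1 ≤ γ) (hγ' : γ ≠ ⊤)
    {f : Space N → ℝ} {G : Space N → F}
    (hf : MemLp f ⊤ volume) (hf' : MemLp f γ volume) (hG : MemLp G γ volume) :
    Tendsto (fun h => eLpNorm (fun x => (f (x + h) - f x) • G x) γ volume) (𝓝 0) (𝓝 0) := by
  have hbd : ∀ h, eLpNorm (fun x => f (x + h) - f x) ⊤ volume ≤ 2 * eLpNorm f ⊤ volume := by
    intro h
    calc _ ≤ eLpNorm (fun x => f (x + h)) ⊤ volume + eLpNorm f ⊤ volume :=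
          eLpNorm_sub_le (MemLp.translate hf h).1 hf.1 le_top
      _ = _ := by rw [eLpNorm_translate hf.1, two_mul]
  refine ENNReal.tendsto_nhds_zero.2 fun ε hε => ?_
  set M := 2 * eLpNorm f ⊤ volume with hM
  have hMtop : M ≠ ⊤ := ENNReal.mul_ne_top (by simp) hf.2.ne
  have hδ : ε / 2 / (M + 1) ≠ 0 :=
    ENNReal.div_ne_zero.2 ⟨(ENNReal.half_pos hε.ne').ne', by simp [hMtop]⟩
  -- Translation is not continuous in `L^∞`, so the smallness must come from `f ∈ L^γ`. This needs a
  -- bounded second factor: hence `G` is replaced by a continuous `g` with compact support, at a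
  -- cost controlled by the sup norm of `f`.
  obtain ⟨g, hgc, hg1, hg2, hg3⟩ := hG.exists_hasCompactSupport_eLpNorm_sub_le hγ' hδ
  obtain ⟨C, hC⟩ := hgc.exists_bound_of_continuous hg2
  have hC' : eLpNorm g ⊤ volume ≠ ⊤ :=
    (memLp_top_of_bound hg3.1 C (Eventually.of_forall hC)).2.ne
  have h1 : Tendsto (fun h => eLpNorm (fun x => f (x + h) - f x) γ volume * eLpNorm g ⊤ volume)
      (𝓝 0) (𝓝 0) := by
    simpa using ENNReal.Tendsto.mul_const (tendsto_eLpNorm_translate_sub hγ hγ' hf') (Or.inr hC')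
  filter_upwards [ENNReal.tendsto_nhds_zero.1 h1 _ (ENNReal.half_pos hε.ne')] with h hh
  have hm : AEStronglyMeasurable (fun x => f (x + h) - f x) volume :=
    (MemLp.translate hf h).1.sub hf.1
  calc eLpNorm (fun x => (f (x + h) - f x) • G x) γ volume
      = eLpNorm ((fun x => f (x + h) - f x) • (G - g) + (fun x => f (x + h) - f x) • g)
          γ volume := by
        congr 1
        ext x
        simp [← smul_add]
    _ ≤ eLpNorm ((fun x => f (x + h) - f x) • (G - g)) γ volume +
          eLpNorm ((fun x => f (x + h) - f x) • g) γ volume :=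
        eLpNorm_add_le (hm.smul (hG.1.sub hg3.1)) (hm.smul hg3.1) hγ
    _ ≤ eLpNorm (fun x => f (x + h) - f x) ⊤ volume * eLpNorm (G - g) γ volume +
          eLpNorm (fun x => f (x + h) - f x) γ volume * eLpNorm g ⊤ volume :=
        add_le_add (eLpNorm_smul_le_mul_eLpNorm (hG.1.sub hg3.1) hm)
          (eLpNorm_smul_le_mul_eLpNorm hg3.1 hm)
    _ ≤ (M + 1) * (ε / 2 / (M + 1)) + ε / 2 :=
        add_le_add (mul_le_mul' ((hbd h).trans le_self_add) hg1) hh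
    _ ≤ ε / 2 + ε / 2 := by gcongr; exact ENNReal.mul_div_le
    _ = ε := ENNReal.add_halves ε

/-- The product of translates of `f ∈ L^p` and `G ∈ L^α` depends continuously on the
translations in `L^γ`, where `1/γ = 1/α + 1/p` and `γ < ∞`. -/
theorem tendsto_eLpNorm_translate_smul_sub {p α γ : ℝ≥0∞} [ht : ENNReal.HolderTriple p α γ]
    (hp : 1 ≤ p) (hγ : 1 ≤ γ) (hγ' : γ ≠ ⊤)
    {f : Space N → ℝ} {G : Space N → F}
    (hf : MemLp f p volume) (hf' : MemLp f γ volume) (hG : MemLp G α volume) :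
    Tendsto (fun hk : Space N × Space N =>
      eLpNorm (fun x => f (x + hk.1) • G (x + hk.2) - f x • G x) γ volume) (𝓝 0) (𝓝 0) := by
  have h1 : Tendsto (fun h => eLpNorm (fun x => (f (x + h) - f x) • G x) γ volume)
      (𝓝 0) (𝓝 0) := by
    rcases eq_or_ne p ⊤ with rfl | hptop
    · have hαγ : α = γ := by
        have := ht.inv_add_inv_eq_inv
        simpa using this
      subst hαγ
      exact tendsto_eLpNorm_translate_sub_smul_top hγ hγ' hf hf' hG
    · have h2 : Tendsto (fun h => eLpNorm (fun x => f (x + h) - f x) p volume *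
          eLpNorm G α volume) (𝓝 0) (𝓝 0) := by
        simpa using ENNReal.Tendsto.mul_const (tendsto_eLpNorm_translate_sub hp hptop hf)
          (Or.inr hG.2.ne)
      refine tendsto_of_tendsto_of_tendsto_of_le_of_le tendsto_const_nhds h2
        (fun _ => zero_le) fun h => ?_
      exact eLpNorm_smul_le_mul_eLpNorm hG.1 ((MemLp.translate hf h).1.sub hf.1)
  -- Up to the translation by `k`, the difference is `(f(· + h - k) - f) G` plus the translation
  -- error of the product `f G ∈ L^γ`. The field `G` alone is never compared with its translates,
  -- which is why `α = ∞` is allowed.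
  have hfG : MemLp (fun x => f x • G x) γ volume := hG.smul hf
  have h2 := tendsto_eLpNorm_translate_sub hγ hγ' hfG
  have hd : Tendsto (fun hk : Space N × Space N => hk.1 - hk.2) (𝓝 0) (𝓝 0) := by
    have : Continuous (fun hk : Space N × Space N => hk.1 - hk.2) := by fun_prop
    simpa using this.tendsto 0
  have hs : Tendsto (fun hk : Space N × Space N => hk.2) (𝓝 0) (𝓝 0) :=
    continuous_snd.tendsto 0
  have h3 := (h1.comp hd).add (h2.comp hs)
  rw [add_zero] at h3
  refine tendsto_of_tendsto_of_tendsto_of_le_of_le tendsto_const_nhds h3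
    (fun _ => zero_le) fun hk => ?_
  obtain ⟨h, k⟩ := hk
  have hm : AEStronglyMeasurable (fun x => (f (x + (h - k)) - f x) • G x) volume :=
    ((MemLp.translate hf _).1.sub hf.1).smul hG.1
  simp only [Function.comp]
  rw [← eLpNorm_translate hm k]
  refine le_trans (le_of_eq ?_) (eLpNorm_add_le
    (hm.comp_measurePreserving (measurePreserving_add_right volume k))
    ((MemLp.translate hfG k).1.sub hfG.1) hγ)
  congr 1
  ext x
  simp [sub_smul, add_assoc]

end

/-! ### Weakly differentiable fields along segments. -/

section

variable {N : ℕ} {F : Type*} [NormedAddCommGroup F]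

/-- Openness follows from compactness of the unit interval. It is what permits testing with smooth
functions supported in this set. -/
theorem isOpen_forall_segment_mem {Ω : Set (Space N)} (hΩ : IsOpen Ω) (h : Space N) :
    IsOpen {x | ∀ s ∈ Icc (0 : ℝ) 1, x + s • h ∈ Ω} := by
  refine isOpen_iff_mem_nhds.2 fun x hx => ?_
  refine isCompact_Icc.eventually_forall_of_forall_eventually fun s hs => ?_
  have hc : Continuous fun z : Space N × ℝ => z.1 + z.2 • h := by fun_prop
  exact hc.continuousAt.eventually (hΩ.mem_nhds (hx s hs))

/-- All translates of `G` have the same `L^1` norm. This justifies the exchanges of the `x`- and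
`s`-integrals below. -/
theorem integrable_translate_segment {G : Space N → F} (hGm : StronglyMeasurable G)
    (hG : Integrable G volume) (h : Space N) :
    Integrable (fun z : Space N × ℝ => G (z.1 + z.2 • h))
      (volume.prod (volume.restrict (Icc (0 : ℝ) 1))) := by
  have hm : StronglyMeasurable fun z : Space N × ℝ => G (z.1 + z.2 • h) :=
    hGm.comp_measurable (by fun_prop)
  refine (integrable_prod_iff' hm.aestronglyMeasurable).2 ⟨?_, ?_⟩
  · exact Eventually.of_forall fun s => hG.comp_add_right (s • h)
  · have : (fun s : ℝ => ∫ x, ‖G (x + s • h)‖) = fun _ => ∫ x, ‖G x‖ := by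
      ext s
      exact integral_add_right_eq_self (fun x => ‖G x‖) (s • h)
    simp only [this]
    exact integrable_const _

/-- The translate of a test function along a segment contained in `Ω`. -/
def translateTest {Ω : Opens (Space N)} {ψ : Space N → ℝ} (hψ : ContDiff ℝ ∞ ψ)
    (hc : HasCompactSupport ψ) (k : Space N) (hk : ∀ x ∈ tsupport ψ, x + k ∈ Ω) : 𝓓(Ω, ℝ) where
  toFun y := ψ (y - k)
  contDiff' := hψ.comp (contDiff_id.sub contDiff_const)
  hasCompactSupport' := by
    have := hc.comp_homeomorph (Homeomorph.addRight (-k))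
    simpa [Function.comp_def, sub_eq_add_neg] using this
  tsupport_subset' := by
    intro y hy
    have h1 : y ∈ (fun y => y - k) ⁻¹' tsupport ψ :=
      tsupport_comp_subset_preimage ψ (f := fun y => y - k) (by fun_prop) hy
    simpa using hk _ h1

theorem integral_test_smul {Ω : Opens (Space N)} [NormedSpace ℝ F] {ψ : Space N → ℝ}
    (hψ : ∀ x ∉ (Ω : Set (Space N)), ψ x = 0) (v : Space N → F) :
    ∫ x in (Ω : Set (Space N)), ψ x • v x = ∫ x, ψ x • v x :=
  setIntegral_eq_integral_of_forall_compl_eq_zero fun x hx => by simp [hψ x hx]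

theorem test_eq_zero {Ω : Opens (Space N)} (ψ : 𝓓(Ω, ℝ)) {x : Space N}
    (hx : x ∉ (Ω : Set (Space N))) : ψ x = 0 :=
  image_eq_zero_of_notMem_tsupport fun h => hx (ψ.tsupport_subset h)

theorem fderiv_test_eq_zero {Ω : Opens (Space N)} (ψ : 𝓓(Ω, ℝ)) {x : Space N}
    (hx : x ∉ (Ω : Set (Space N))) : fderiv ℝ ψ x = 0 :=
  image_eq_zero_of_notMem_tsupport fun h => hx (ψ.tsupport_subset (tsupport_fderiv_subset ℝ h))

/-- A weakly differentiable field is, along almost every segment contained in the domain, the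
integral of its weak derivative. -/
theorem IsWeakDeriv.ae_sub_eq_integral {Ω : Opens (Space N)} {v : Space N → Space N}
    {G : Space N → (Space N →L[ℝ] Space N)} (hv : Integrable v volume)
    (hGm : StronglyMeasurable G) (hG : Integrable G volume) (hw : IsWeakDeriv Ω v G)
    (h : Space N) :
    ∀ᵐ x, (∀ s ∈ Icc (0 : ℝ) 1, x + s • h ∈ Ω) →
      IntegrableOn (fun s : ℝ => G (x + s • h)) (Icc 0 1) ∧
        v (x + h) - v x = ∫ s in Icc (0 : ℝ) 1, G (x + s • h) h := by
  have hI := integrable_translate_segment hGm hG h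
  have hIh : Integrable (fun z : Space N × ℝ => G (z.1 + z.2 • h) h)
      (volume.prod (volume.restrict (Icc (0 : ℝ) 1))) := hI.apply_continuousLinearMap h
  have hvh : Integrable (fun x => v (x + h)) := hv.comp_add_right h
  have hint : Integrable
      (fun x => v (x + h) - v x - ∫ s in Icc (0 : ℝ) 1, G (x + s • h) h) volume :=
    (hvh.sub hv).sub hIh.integral_prod_left
  have key : ∀ᵐ x, x ∈ {x | ∀ s ∈ Icc (0 : ℝ) 1, x + s • h ∈ (Ω : Set (Space N))} →
      v (x + h) - v x - ∫ s in Icc (0 : ℝ) 1, G (x + s • h) h = 0 := by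
    -- If `ψ` is supported in this open set, every translate `ψ(· - s h)` with `s ∈ [0,1]` is a test
    -- function on `Ω`, so the weak derivative can be tested with all of them.
    refine (isOpen_forall_segment_mem Ω.isOpen h).ae_eq_zero_of_integral_contDiff_smul_eq_zero
      (hint.locallyIntegrable.locallyIntegrableOn _) fun ψ hψ hψc hψs => ?_
    have hψd : Differentiable ℝ ψ := hψ.differentiable (by simp)
    obtain ⟨C, hC⟩ := hψc.exists_bound_of_continuous hψ.continuous
    have hψ' : Continuous fun x => fderiv ℝ ψ x h :=
      (hψ.continuous_fderiv (by simp)).clm_apply continuous_const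
    obtain ⟨C', hC'⟩ := (hψc.fderiv_apply (𝕜 := ℝ) h).exists_bound_of_continuous hψ'
    have bdd : ∀ {w : Space N → Space N}, Integrable w volume →
        Integrable (fun x => ψ x • w x) volume := fun hw' =>
      hw'.bdd_smul C hψ.continuous.aestronglyMeasurable (Eventually.of_forall hC)
    -- the weak derivative tested with the translates of `ψ`
    have hs : ∀ s ∈ Icc (0 : ℝ) 1, ∫ x, ψ x • G (x + s • h) h =
        - ∫ y, fderiv ℝ ψ (y - s • h) h • v y := by
      intro s hs
      have hk : ∀ x ∈ tsupport ψ, x + s • h ∈ Ω := fun x hx => hψs hx s hs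
      have hh := hw (translateTest hψ hψc (s • h) hk) h
      have e1 : ∀ y, translateTest hψ hψc (s • h) hk y = ψ (y - s • h) := fun y => rfl
      have e2 : ∀ y, fderiv ℝ (translateTest hψ hψc (s • h) hk) y = fderiv ℝ ψ (y - s • h) := by
        intro y
        exact fderiv_comp_sub (f := ψ) (𝕜 := ℝ) (x := y) (s • h)
      rw [integral_test_smul (ψ := fun x => fderiv ℝ (translateTest hψ hψc (s • h) hk) x h)
          (fun x hx => by simp [fderiv_test_eq_zero _ hx]) v,
        integral_test_smul (fun x hx => test_eq_zero _ hx)] at hh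
      simp only [e1, e2] at hh
      rw [hh, neg_neg, ← integral_add_right_eq_self (fun y => ψ (y - s • h) • G y h) (s • h)]
      simp
    have hm1 : Integrable (fun z : Space N × ℝ => ψ z.1 • G (z.1 + z.2 • h) h)
        (volume.prod (volume.restrict (Icc (0 : ℝ) 1))) :=
      hIh.bdd_smul C (hψ.continuous.comp continuous_fst).aestronglyMeasurable
        (Eventually.of_forall fun z => hC _)
    have hm2 : Integrable (fun z : Space N × ℝ => fderiv ℝ ψ (z.1 - z.2 • h) h • v z.1)
        (volume.prod (volume.restrict (Icc (0 : ℝ) 1))) :=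
      (hv.comp_fst _).bdd_smul C'
        (hψ'.comp (by fun_prop : Continuous fun z : Space N × ℝ => z.1 - z.2 • h)
          ).aestronglyMeasurable
        (Eventually.of_forall fun z => hC' _)
    have hftc : ∀ y, ∫ s in Icc (0 : ℝ) 1, fderiv ℝ ψ (y - s • h) h = ψ y - ψ (y - h) := by
      intro y
      have hd : ∀ s ∈ uIcc (0 : ℝ) 1,
          HasDerivAt (fun s : ℝ => - ψ (y - s • h)) (fderiv ℝ ψ (y - s • h) h) s := by
        intro s _
        have h1 : HasDerivAt (fun s : ℝ => y - s • h) (-h) s := by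
          simpa using ((hasDerivAt_id s).smul_const h).const_sub y
        have h2 := ((hψd (y - s • h)).hasFDerivAt.comp_hasDerivAt s h1).neg
        rw [map_neg, neg_neg] at h2
        exact h2
      have hcont : Continuous fun s : ℝ => fderiv ℝ ψ (y - s • h) h :=
        hψ'.comp (by fun_prop)
      rw [integral_Icc_eq_integral_Ioc, ← intervalIntegral.integral_of_le zero_le_one,
        intervalIntegral.integral_eq_sub_of_hasDerivAt hd (hcont.intervalIntegrable _ _)]
      simp
      ring
    -- With the integrals exchanged, the weak derivative passes from `v` to the translates of `ψ`.
    -- After exchanging back, the inner `s`-integral is that of an exact derivative.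
    have e3 : ∫ x, ψ x • ∫ s in Icc (0 : ℝ) 1, G (x + s • h) h =
        - ∫ y, (ψ y - ψ (y - h)) • v y := by
      calc _ = ∫ x, ∫ s in Icc (0 : ℝ) 1, ψ x • G (x + s • h) h := by
            simp only [integral_smul]
        _ = ∫ s in Icc (0 : ℝ) 1, ∫ x, ψ x • G (x + s • h) h := integral_integral_swap hm1
        _ = ∫ s in Icc (0 : ℝ) 1, - ∫ y, fderiv ℝ ψ (y - s • h) h • v y :=
            setIntegral_congr_fun measurableSet_Icc hs
        _ = - ∫ y, ∫ s in Icc (0 : ℝ) 1, fderiv ℝ ψ (y - s • h) h • v y := by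
            rw [integral_neg, integral_integral_swap]
            exact hm2.swap
        _ = _ := by
            simp only [integral_smul_const, hftc]
    have e4 : ∫ x, ψ x • v (x + h) = ∫ y, ψ (y - h) • v y := by
      rw [← integral_add_right_eq_self (fun y => ψ (y - h) • v y) h]
      simp
    have hb : Integrable (fun y => ψ (y - h) • v y) volume := by
      have := (bdd hvh).comp_sub_right h
      simpa using this
    simp only [smul_sub, sub_smul] at e3 ⊢
    have hA : Integrable (fun x => ψ x • v (x + h) - ψ x • v x) volume :=
      (bdd hvh).sub (bdd hv)
    have hB : Integrable (fun x => ψ x • ∫ s in Icc (0 : ℝ) 1, G (x + s • h) h) volume :=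
      bdd hIh.integral_prod_left
    rw [integral_sub hA hB, integral_sub (bdd hvh) (bdd hv), e3, e4, integral_sub (bdd hv) hb]
    simp
  filter_upwards [key, hI.prod_right_ae] with x hx hx2 hseg
  exact ⟨hx2, sub_eq_zero.1 (hx hseg)⟩

end

/-! ### An integral Minkowski bound, traces, and the rescaled commutator. -/

section

variable {N : ℕ}

/-- If `‖r x‖ ≤ c ∫ F(x, w) dμ(w)` and `‖F(·, w)‖_γ ≤ δ` for all `w`, then
`‖r‖_γ ≤ c μ(W) δ`. -/
theorem eLpNorm_le_of_enorm_le_lintegral {X W : Type*} [MeasurableSpace X] [MeasurableSpace W]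
    {ν : Measure X} [SFinite ν] {μ : Measure W} [IsFiniteMeasure μ]
    {γ : ℝ≥0∞} (hγ : 1 ≤ γ) (hγ' : γ ≠ ⊤) {r : X → ℝ} {F : X → W → ℝ≥0∞}
    (hF : Measurable (Function.uncurry F)) {c δ : ℝ≥0∞}
    (hr : ∀ᵐ x ∂ν, ‖r x‖ₑ ≤ c * ∫⁻ w, F x w ∂μ)
    (hδ : ∀ᵐ w ∂μ, eLpNorm (fun x => F x w) γ ν ≤ δ) :
    eLpNorm r γ ν ≤ c * (μ univ * δ) := by
  have hγ0 : γ ≠ 0 := (zero_lt_one.trans_le hγ).ne'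
  set g := γ.toReal with hg
  have hg1 : 1 ≤ g := by
    simpa [hg] using (ENNReal.toReal_le_toReal (by simp) hγ').2 hγ
  have hg0 : 0 < g := by linarith
  have hgne : g ≠ 0 := hg0.ne'
  -- Hölder in `w` against the constant 1. Tonelli then brings the `x`-norm inside, and the factor
  -- `μ univ` from integrating `δ ^ g` completes the power `g - 1` to `g`.
  have hJ : ∀ x, (∫⁻ w, F x w ∂μ) ^ g ≤ (∫⁻ w, F x w ^ g ∂μ) * μ univ ^ (g - 1) := by
    intro x
    have hm : Measurable (F x) := hF.comp measurable_prodMk_left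
    have h := eLpNorm_le_eLpNorm_mul_rpow_measure_univ (μ := μ) hγ
      (hm.aestronglyMeasurable)
    rw [eLpNorm_one_eq_lintegral_enorm, eLpNorm_eq_lintegral_rpow_enorm_toReal hγ0 hγ'] at h
    simp only [enorm_eq_self, ← hg, ENNReal.toReal_one, div_one] at h
    calc _ ≤ ((∫⁻ w, F x w ^ g ∂μ) ^ (1 / g) * μ univ ^ (1 - 1 / g)) ^ g :=
          ENNReal.rpow_le_rpow h hg0.le
      _ = _ := by
          rw [ENNReal.mul_rpow_of_nonneg _ _ hg0.le, ← ENNReal.rpow_mul, ← ENNReal.rpow_mul]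
          congr 2
          · rw [one_div_mul_cancel hgne, ENNReal.rpow_one]
          · field_simp
  have hδ' : ∀ᵐ w ∂μ, ∫⁻ x, F x w ^ g ∂ν ≤ δ ^ g := by
    filter_upwards [hδ] with w hw
    rw [eLpNorm_eq_lintegral_rpow_enorm_toReal hγ0 hγ'] at hw
    simp only [enorm_eq_self, ← hg] at hw
    calc _ = ((∫⁻ x, F x w ^ g ∂ν) ^ (1 / g)) ^ g := by
          rw [← ENNReal.rpow_mul, one_div_mul_cancel hgne, ENNReal.rpow_one]
      _ ≤ δ ^ g := ENNReal.rpow_le_rpow hw hg0.le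
  calc eLpNorm r γ ν ≤ eLpNorm (fun x => c * ∫⁻ w, F x w ∂μ) γ ν :=
        eLpNorm_mono_enorm_ae (by simpa using hr)
    _ = (∫⁻ x, (c * ∫⁻ w, F x w ∂μ) ^ g ∂ν) ^ (1 / g) := by
        rw [eLpNorm_eq_lintegral_rpow_enorm_toReal hγ0 hγ']
        simp only [enorm_eq_self, ← hg]
    _ = (c ^ g * ∫⁻ x, (∫⁻ w, F x w ∂μ) ^ g ∂ν) ^ (1 / g) := by
        simp only [ENNReal.mul_rpow_of_nonneg _ _ hg0.le]
        rw [lintegral_const_mul]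
        exact hF.lintegral_prod_right'.pow_const g
    _ ≤ (c ^ g * (μ univ ^ g * δ ^ g)) ^ (1 / g) := by
        refine ENNReal.rpow_le_rpow (mul_le_mul_right ?_ _) (by positivity)
        calc _ ≤ ∫⁻ x, (∫⁻ w, F x w ^ g ∂μ) * μ univ ^ (g - 1) ∂ν := lintegral_mono hJ
          _ = (∫⁻ x, ∫⁻ w, F x w ^ g ∂μ ∂ν) * μ univ ^ (g - 1) :=
              lintegral_mul_const _ (hF.pow_const g).lintegral_prod_right'
          _ = (∫⁻ w, ∫⁻ x, F x w ^ g ∂ν ∂μ) * μ univ ^ (g - 1) := by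
              rw [lintegral_lintegral_swap]
              exact (hF.pow_const g).aemeasurable
          _ ≤ (∫⁻ _, δ ^ g ∂μ) * μ univ ^ (g - 1) :=
              mul_le_mul_left (lintegral_mono_ae hδ') _
          _ = _ := by
              rw [lintegral_const, mul_assoc, mul_comm]
              congr 1
              nth_rewrite 1 [← ENNReal.rpow_one (μ univ)]
              rw [← ENNReal.rpow_add_of_nonneg _ _ (by simp) (by linarith)]
              congr 1
              ring
    _ = _ := by
        rw [← ENNReal.mul_rpow_of_nonneg _ _ hg0.le, ← ENNReal.mul_rpow_of_nonneg _ _ hg0.le,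
          ← ENNReal.rpow_mul, mul_one_div_cancel hgne, ENNReal.rpow_one]

/-- The trace of an endomorphism, in the standard basis. -/
def trace (A : Space N →L[ℝ] Space N) : ℝ :=
  ∑ i, inner ℝ (EuclideanSpace.basisFun (Fin N) ℝ i) (A (EuclideanSpace.basisFun (Fin N) ℝ i))

theorem apply_eq_sum_inner_mul (L : Space N →L[ℝ] ℝ) (w : Space N) :
    L w = ∑ i, inner ℝ (EuclideanSpace.basisFun (Fin N) ℝ i) w *
      L (EuclideanSpace.basisFun (Fin N) ℝ i) := by
  conv_lhs => rw [← (EuclideanSpace.basisFun (Fin N) ℝ).sum_repr' w]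
  simp only [map_sum, map_smul, smul_eq_mul]

/-- A weakly divergence-free field has a traceless weak derivative. -/
theorem IsWeakDeriv.ae_trace_eq_zero {Ω : Opens (Space N)} {v : Space N → Space N}
    {G : Space N → (Space N →L[ℝ] Space N)} (hv : Integrable v volume)
    (hG : Integrable G volume) (hw : IsWeakDeriv Ω v G) (hdiv : IsDivFree Ω v) :
    ∀ᵐ x, x ∈ (Ω : Set (Space N)) → trace (G x) = 0 := by
  set b := EuclideanSpace.basisFun (Fin N) ℝ with hb
  have hGi : ∀ i, Integrable (fun x => inner ℝ (b i) (G x (b i))) volume := fun i =>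
    (innerSL ℝ (b i)).integrable_comp (hG.apply_continuousLinearMap (b i))
  have hint : Integrable (fun x => trace (G x)) volume := integrable_finsetSum _ fun i _ => hGi i
  refine Ω.isOpen.ae_eq_zero_of_integral_contDiff_smul_eq_zero
      (hint.locallyIntegrable.locallyIntegrableOn _) fun ψ₀ hψ hψc hψs => ?_
  let ψ : 𝓓(Ω, ℝ) := ⟨ψ₀, hψ, hψc, hψs⟩
  change ∫ x, ψ x • trace (G x) = 0
  obtain ⟨C, hC⟩ := ψ.hasCompactSupport.exists_bound_of_continuous ψ.continuous
  have hψ' : ∀ h, Continuous fun x => fderiv ℝ ψ x h := fun h =>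
    (ψ.contDiff.continuous_fderiv (by simp)).clm_apply continuous_const
  have hterm : ∀ i, ∫ x, ψ x • inner ℝ (b i) (G x (b i)) =
      - ∫ x, inner ℝ (b i) (v x) * fderiv ℝ ψ x (b i) := by
    intro i
    obtain ⟨C', hC'⟩ := (ψ.hasCompactSupport.fderiv_apply (𝕜 := ℝ) (b i)
      ).exists_bound_of_continuous (hψ' (b i))
    have hh := hw ψ (b i)
    rw [integral_test_smul (ψ := fun x => fderiv ℝ ψ x (b i))
          (fun x hx => by simp [fderiv_test_eq_zero _ hx]) v,
        integral_test_smul (fun x hx => test_eq_zero _ hx)] at hh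
    have h1 := (innerSL ℝ (b i)).integral_comp_comm (φ := fun x => ψ x • G x (b i))
      ((hG.apply_continuousLinearMap (b i)).bdd_smul C ψ.continuous.aestronglyMeasurable
        (Eventually.of_forall hC))
    have h2 := (innerSL ℝ (b i)).integral_comp_comm (φ := fun x => fderiv ℝ ψ x (b i) • v x)
      (hv.bdd_smul C' (hψ' (b i)).aestronglyMeasurable (Eventually.of_forall hC'))
    rw [hh, map_neg] at h2
    simp only [map_smul, innerSL_apply_apply, smul_eq_mul] at h1 h2 ⊢
    rw [h1, ← neg_eq_iff_eq_neg, ← h2]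
    simp only [mul_comm]
  have hdiv' : ∫ x, fderiv ℝ ψ x (v x) = 0 := by
    rw [← hdiv ψ]
    exact (setIntegral_eq_integral_of_forall_compl_eq_zero fun x hx => by
      simp [fderiv_test_eq_zero _ hx]).symm
  -- Testing the `i`-th component in the direction `b i` and summing produces `-∫ v · ∇ψ`, which
  -- vanishes.
  simp only [trace, Finset.smul_sum, ← hb]
  rw [integral_finsetSum]
  · simp only [hterm]
    rw [Finset.sum_neg_distrib, ← integral_finsetSum]
    · rw [neg_eq_zero, ← hdiv']
      simp only [apply_eq_sum_inner_mul (fderiv ℝ ψ _) (v _), hb]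
    · intro i _
      obtain ⟨C', hC'⟩ := (ψ.hasCompactSupport.fderiv_apply (𝕜 := ℝ) (b i)
        ).exists_bound_of_continuous (hψ' (b i))
      exact Integrable.mul_bdd ((innerSL ℝ (b i)).integrable_comp hv)
        (hψ' (b i)).aestronglyMeasurable (Eventually.of_forall hC')
  · intro i _
    exact (hGi i).bdd_smul C ψ.continuous.aestronglyMeasurable (Eventually.of_forall hC)

/-- `∫ ∇η(z) · A z dz = - tr A ∫ η`. -/
theorem integral_fderiv_apply_linear {η : Space N → ℝ} (hη : ContDiff ℝ ∞ η)
    (hc : HasCompactSupport η) (A : Space N →L[ℝ] Space N) :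
    ∫ z, fderiv ℝ η z (A z) = - (trace A * ∫ z, η z) := by
  set b := EuclideanSpace.basisFun (Fin N) ℝ with hb
  have hη' : ∀ h, Continuous fun x => fderiv ℝ η x h := fun h =>
    (hη.continuous_fderiv (by simp)).clm_apply continuous_const
  have hi1 : ∀ i, Integrable (fun z => inner ℝ (b i) (A z) * fderiv ℝ η z (b i)) volume := by
    intro i
    refine Continuous.integrable_of_hasCompactSupport
      ((continuous_const.inner A.continuous).mul (hη' _)) ?_
    exact (hc.fderiv_apply (𝕜 := ℝ) (b i)).mul_left
  have hterm : ∀ i, ∫ z, inner ℝ (b i) (A z) * fderiv ℝ η z (b i) =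
      - (inner ℝ (b i) (A (b i)) * ∫ z, η z) := by
    intro i
    let L : Space N →L[ℝ] ℝ := (innerSL ℝ (b i)).comp A
    have hL : ∀ z, inner ℝ (b i) (A z) = L z := fun z => by simp [L]
    simp only [hL]
    rw [integral_mul_fderiv_eq_neg_fderiv_mul_of_integrable]
    · simp only [ContinuousLinearMap.fderiv]
      rw [integral_const_mul]
    · simp only [ContinuousLinearMap.fderiv]
      exact (hη.continuous.integrable_of_hasCompactSupport hc).const_mul _
    · simpa only [hL] using hi1 i
    · exact Continuous.integrable_of_hasCompactSupport (L.continuous.mul hη.continuous)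
        hc.mul_left
    · exact fun x _ => L.differentiableAt
    · exact fun x _ => hη.differentiable (by simp) x
  simp only [apply_eq_sum_inner_mul (fderiv ℝ η _) (A _), ← hb]
  rw [integral_finsetSum _ fun i _ => hi1 i]
  simp only [hterm, Finset.sum_neg_distrib, trace, Finset.sum_mul, ← hb]

theorem contDiff_kernel {η : Space N → ℝ} (hη : ContDiff ℝ ∞ η) (ε : ℝ) :
    ContDiff ℝ ∞ (kernel η ε) :=
  contDiff_const.mul (hη.comp (contDiff_const_smul _))

theorem fderiv_kernel_sub {η : Space N → ℝ} (hη : ContDiff ℝ ∞ η) (ε : ℝ) (x y w : Space N) :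
    fderiv ℝ (fun z => kernel η ε (z - y)) x w =
      ε⁻¹ ^ N * fderiv ℝ η (ε⁻¹ • (x - y)) (ε⁻¹ • w) := by
  have h1 : HasFDerivAt (fun z : Space N => ε⁻¹ • (z - y))
      (ε⁻¹ • ContinuousLinearMap.id ℝ (Space N)) x :=
    ((hasFDerivAt_id x).sub_const y).const_smul ε⁻¹
  have h2 := ((hη.differentiable (by simp) (ε⁻¹ • (x - y))).hasFDerivAt.comp x h1).const_mul
    (ε⁻¹ ^ N)
  have h3 : HasFDerivAt (fun z => kernel η ε (z - y)) _ x := h2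
  rw [h3.fderiv]
  simp

/-- The commutator error of the mollification, at a fixed time. -/
def spatialCommutator (Ω : Set (Space N)) (η : Space N → ℝ) (v : Space N → Space N)
    (f : Space N → ℝ) (ε : ℝ) (x : Space N) : ℝ :=
  ∫ y in Ω, f y * fderiv ℝ (fun z => kernel η ε (z - y)) x (v y - v x)

/-- The substitution `y = x - ε z` absorbs the factor `ε⁻¹ ^ N` of the kernel, and the extra `ε⁻¹`
from its gradient turns the increment of `v` into a difference quotient. Integrating over the whole
space is possible because `f` vanishes off `Ω`. -/
theorem spatialCommutator_eq_integral {Ω : Set (Space N)} {η : Space N → ℝ}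
    (hη : ContDiff ℝ ∞ η) (v : Space N → Space N) {f : Space N → ℝ} (hf : ∀ x ∉ Ω, f x = 0)
    {ε : ℝ} (hε : 0 < ε) (x : Space N) :
    spatialCommutator Ω η v f ε x =
      ∫ z, f (x - ε • z) * fderiv ℝ η z (ε⁻¹ • (v (x - ε • z) - v x)) := by
  rw [spatialCommutator, setIntegral_eq_integral_of_forall_compl_eq_zero
    (fun y hy => by simp [hf y hy])]
  simp only [fderiv_kernel_sub hη]
  rw [← integral_sub_left_eq_self _ volume x]
  have h := Measure.integral_comp_smul (volume : Measure (Space N))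
    (fun y => f (x - y) * (ε⁻¹ ^ N * fderiv ℝ η (ε⁻¹ • (x - (x - y)))
      (ε⁻¹ • (v (x - y) - v x)))) ε
  rw [finrank_euclideanSpace_fin, abs_of_pos (by positivity), eq_comm,
    inv_smul_eq_iff₀ (by positivity)] at h
  rw [h, ← integral_smul]
  congr 1
  ext z
  rw [sub_sub_cancel, inv_smul_smul₀ hε.ne', smul_eq_mul]
  have h1 : ε ^ N * ε⁻¹ ^ N = 1 := by rw [← mul_pow, mul_inv_cancel₀ hε.ne', one_pow]
  linear_combination (f (x - ε • z) * fderiv ℝ η z (ε⁻¹ • (v (x - ε • z) - v x))) * h1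

end

/-! ### Pointwise bound of the commutator by a detour along three segments. -/

section

variable {N : ℕ}

/-- On the segment from `y` to `y + h`, the field `v` is the integral of `G`. -/
def SegmentIdentity (v : Space N → Space N) (G : Space N → (Space N →L[ℝ] Space N))
    (y h : Space N) : Prop :=
  IntegrableOn (fun s : ℝ => G (y + s • h)) (Icc 0 1) ∧
    v (y + h) - v y = ∫ s in Icc (0 : ℝ) 1, G (y + s • h) h

/-- The identity is known for almost every `x` once the shift is fixed. Joint measurability lets the
quantifiers be exchanged, so that for almost every `x` it holds for almost every `z`. -/
theorem measurableSet_segmentIdentity {v : Space N → Space N}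
    {G : Space N → (Space N →L[ℝ] Space N)} (hv : StronglyMeasurable v)
    (hG : StronglyMeasurable G) :
    MeasurableSet {z : Space N × Space N | SegmentIdentity v G z.1 z.2} := by
  have h1 : StronglyMeasurable
      (Function.uncurry fun (z : Space N × Space N) (s : ℝ) => G (z.1 + s • z.2)) :=
    hG.comp_measurable (f := G)
      (g := fun w : (Space N × Space N) × ℝ => w.1.1 + w.2 • w.1.2) (by fun_prop)
  have h2 : StronglyMeasurable
      (Function.uncurry fun (z : Space N × Space N) (s : ℝ) => G (z.1 + s • z.2) z.2) := by
    have hb : StronglyMeasurable fun w : (Space N × Space N) × ℝ => w.1.2 :=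
      Measurable.stronglyMeasurable (by fun_prop)
    exact (ContinuousLinearMap.apply ℝ (Space N)).flip.continuous₂.comp_stronglyMeasurable
      (h1.prodMk hb)
  refine MeasurableSet.inter (measurableSet_integrable h1) (measurableSet_eq_fun ?_ ?_)
  · exact ((hv.comp_measurable (by fun_prop : Measurable
      fun z : Space N × Space N => z.1 + z.2)).sub (hv.comp_measurable measurable_fst)).measurable
  · exact h2.integral_prod_right.measurable

/-- The points of `A` can be shifted by `ε ν` inside `Ω`, so far that a ball of radius `ε` about
the shifted point lies in `Ω`, and so can the points of `Ω` that are `ε`-close to `A`. -/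
def HasInwardShift (Ω A : Set (Space N)) (ν : Space N) (ε : ℝ) : Prop :=
  ∀ x ∈ A, ∀ z : Space N, ‖z‖ ≤ 1 → ∀ s ∈ Icc (0 : ℝ) 1,
    x + s • (ε • ν) ∈ Ω ∧ x + ε • ν + s • (ε • -z) ∈ Ω ∧
      (x - ε • z ∈ Ω → x - ε • z + s • (ε • ν) ∈ Ω)

/-- The deviation of the products of translates of `f` and `G` from `f G`, along the three
segments that join `x` to `x - ε z`. -/
def shiftError (f : Space N → ℝ) (G : Space N → (Space N →L[ℝ] Space N)) (ν : Space N) (ε : ℝ)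
    (x : Space N) (w : Space N × ℝ) : ℝ≥0∞ :=
  ‖f (x + -(ε • w.1)) • G (x + (w.2 • ε • ν - ε • w.1)) - f x • G x‖ₑ +
    ‖f (x + -(ε • w.1)) • G (x + (ε • ν - w.2 • ε • w.1)) - f x • G x‖ₑ +
      ‖f (x + -(ε • w.1)) • G (x + w.2 • ε • ν) - f x • G x‖ₑ

/-- Lebesgue measure on the product of the unit ball and the unit interval. -/
def segMeasure (N : ℕ) : Measure (Space N × ℝ) :=
  (volume.restrict (Metric.closedBall 0 1)).prod (volume.restrict (Icc 0 1))

instance : IsFiniteMeasure (volume.restrict (Metric.closedBall (0 : Space N) 1)) :=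
  ⟨by simpa using (isCompact_closedBall (0 : Space N) 1).measure_lt_top⟩

instance : IsFiniteMeasure (segMeasure N) := by
  unfold segMeasure
  infer_instance

theorem measurable_shiftError {f : Space N → ℝ} {G : Space N → (Space N →L[ℝ] Space N)}
    (hf : StronglyMeasurable f) (hG : StronglyMeasurable G) (ν : Space N) (ε : ℝ) :
    Measurable (Function.uncurry (shiftError f G ν ε)) := by
  have hf' : ∀ {g : Space N × Space N × ℝ → Space N}, Measurable g →
      StronglyMeasurable fun w => f (g w) := fun hg => hf.comp_measurable hg
  have hG' : ∀ {g : Space N × Space N × ℝ → Space N}, Measurable g →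
      StronglyMeasurable fun w => G (g w) := fun hg => hG.comp_measurable hg
  have h0 : StronglyMeasurable fun w : Space N × Space N × ℝ => f w.1 • G w.1 :=
    (hf' measurable_fst).smul (hG' measurable_fst)
  have h1 : StronglyMeasurable fun w : Space N × Space N × ℝ => f (w.1 + -(ε • w.2.1)) :=
    hf' (by fun_prop)
  have h2 : ∀ {g : Space N × Space N × ℝ → Space N}, Measurable g →
      Measurable fun w => ‖f (w.1 + -(ε • w.2.1)) • G (g w) - f w.1 • G w.1‖ₑ :=
    fun hg => ((h1.smul (hG' hg)).sub h0).enorm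
  exact ((h2 (by fun_prop)).add (h2 (by fun_prop))).add (h2 (by fun_prop))

/-- Almost every segment that occurs in the definition of `HasInwardShift` carries the segment
identity. -/
theorem ae_ae_segmentIdentity {Ω : Opens (Space N)} {v : Space N → Space N}
    {G : Space N → (Space N →L[ℝ] Space N)} (hvm : StronglyMeasurable v)
    (hv : Integrable v volume) (hGm : StronglyMeasurable G) (hG : Integrable G volume)
    (hw : IsWeakDeriv Ω v G) {A : Set (Space N)} (hAm : MeasurableSet A) {ν : Space N} {ε : ℝ}
    (hA : HasInwardShift Ω A ν ε) :
    ∀ᵐ x, ∀ᵐ z : Space N, x ∈ A → ‖z‖ ≤ 1 → SegmentIdentity v G x (ε • ν) ∧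
      SegmentIdentity v G (x + ε • ν) (ε • -z) ∧
      (x - ε • z ∈ (Ω : Set (Space N)) → SegmentIdentity v G (x - ε • z) (ε • ν)) := by
  have hS := measurableSet_segmentIdentity hvm hGm
  have hS' : ∀ {g : Space N × Space N → Space N × Space N}, Measurable g →
      MeasurableSet {w | SegmentIdentity v G (g w).1 (g w).2} := fun hg => hg hS
  refine (Measure.ae_ae_comm ?_).2 ?_
  · simp only [imp_iff_not_or, ofPred_or, ofPred_and]
    refine (measurable_fst hAm).compl.union (((measurableSet_le measurable_snd.norm
      measurable_const).compl).union ((hS' (g := fun w => (w.1, ε • ν)) (by fun_prop)).inter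
      ((hS' (g := fun w => (w.1 + ε • ν, ε • -w.2)) (by fun_prop)).inter
      (MeasurableSet.union (MeasurableSet.compl ?_)
        (hS' (g := fun w => (w.1 - ε • w.2, ε • ν)) (by fun_prop))))))
    exact (by fun_prop : Measurable fun w : Space N × Space N => w.1 - ε • w.2)
      Ω.isOpen.measurableSet
  · refine Eventually.of_forall fun z => ?_
    have h1 := hw.ae_sub_eq_integral hv hGm hG (ε • ν)
    -- The second and third segments start at shifted points; the exceptional null sets are pulled
    -- back along translations, which preserve null sets.
    have h2 := hw.ae_sub_eq_integral hv hGm hG (ε • -z)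
    have h3 := (measurePreserving_add_right (volume : Measure (Space N)) (ε • ν)
      ).quasiMeasurePreserving.ae h2
    have h4 := (measurePreserving_sub_right (volume : Measure (Space N)) (ε • z)
      ).quasiMeasurePreserving.ae h1
    filter_upwards [h1, h3, h4] with x h1 h3 h4 hx hz
    exact ⟨h1 fun s hs => (hA x hx z hz s hs).1, h3 fun s hs => (hA x hx z hz s hs).2.1,
      fun hxz => h4 fun s hs => (hA x hx z hz s hs).2.2 hxz⟩

theorem SegmentIdentity.smul_difference {v : Space N → Space N}
    {G : Space N → (Space N →L[ℝ] Space N)} {y e : Space N} {ε : ℝ} (hε : 0 < ε) (c : ℝ)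
    (h : SegmentIdentity v G y (ε • e)) :
    c • ε⁻¹ • (v (y + ε • e) - v y) = ∫ s in Icc (0 : ℝ) 1, (c • G (y + s • ε • e)) e := by
  rw [h.2, ← integral_smul, ← integral_smul]
  refine setIntegral_congr_fun measurableSet_Icc fun s _ => ?_
  simp only [map_smul, inv_smul_smul₀ hε.ne', smul_apply]

theorem integrableOn_zero_smul {F : Type*} [NormedAddCommGroup F] [NormedSpace ℝ F] (g : ℝ → F)
    (S : Set ℝ) : IntegrableOn (fun s => (0 : ℝ) • g s) S := by
  simp only [zero_smul]
  exact integrableOn_zero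

/-- The path runs from `x` to `x + ε ν`, on to `x + ε ν - ε z`, and back along `-ν` to `x - ε z`.
Its directions `ν`, `-z`, `-ν` add up to `-z`, so subtracting `B` on each leg subtracts `-B z` in
total, which is the `+ B z` on the left. For `c = 0` everything but `B` drops out, and nothing is
needed on the third segment. -/
theorem segment_difference {v : Space N → Space N}
    {G : Space N → (Space N →L[ℝ] Space N)} {x z ν : Space N} {ε c : ℝ} (hε : 0 < ε)
    (B : Space N →L[ℝ] Space N) (h1 : SegmentIdentity v G x (ε • ν))
    (h2 : SegmentIdentity v G (x + ε • ν) (ε • -z))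
    (h3 : c = 0 ∨ SegmentIdentity v G (x - ε • z) (ε • ν)) :
    c • ε⁻¹ • (v (x - ε • z) - v x) + B z = ∫ s in Icc (0 : ℝ) 1,
      ((c • G (x + (s • ε • ν - ε • z)) - B) (-ν) +
        (c • G (x + (ε • ν - s • ε • z)) - B) (-z) + (c • G (x + s • ε • ν) - B) ν) := by
  have p1 : ∀ s : ℝ, x - ε • z + s • ε • ν = x + (s • ε • ν - ε • z) := fun s => by module
  have p2 : ∀ s : ℝ, x + ε • ν + s • ε • -z = x + (ε • ν - s • ε • z) := fun s => by module
  have p3 : x + ε • ν + ε • -z = x - ε • z + ε • ν := by module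
  have i3 : IntegrableOn (fun s : ℝ => c • G (x + s • ε • ν)) (Icc 0 1) := h1.1.smul c
  have i2 : IntegrableOn (fun s : ℝ => c • G (x + (ε • ν - s • ε • z))) (Icc 0 1) := by
    have : IntegrableOn (fun s : ℝ => c • G (x + ε • ν + s • ε • -z)) (Icc 0 1) := h2.1.smul c
    simp only [p2] at this
    exact this
  have i1 : IntegrableOn (fun s : ℝ => c • G (x + (s • ε • ν - ε • z))) (Icc 0 1) := by
    rcases h3 with rfl | h3
    · exact integrableOn_zero_smul _ _
    · have : IntegrableOn (fun s : ℝ => c • G (x - ε • z + s • ε • ν)) (Icc 0 1) := h3.1.smul c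
      simp only [p1] at this
      exact this
  have e3 := h1.smul_difference hε c
  have e2 := h2.smul_difference hε c
  have e1 : c • ε⁻¹ • (v (x - ε • z) - v (x - ε • z + ε • ν)) =
      ∫ s in Icc (0 : ℝ) 1, (c • G (x + (s • ε • ν - ε • z))) (-ν) := by
    rcases h3 with rfl | h3
    · simp
    have := h3.smul_difference hε c
    simp only [p1] at this
    simp only [map_neg, integral_neg, ← this]
    module
  simp only [p2] at e2
  have iB : ∀ w : Space N, IntegrableOn (fun _ : ℝ => B w) (Icc 0 1) := fun w =>
    integrable_const _
  have j1 := i1.integrable.apply_continuousLinearMap (-ν)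
  have j2 := i2.integrable.apply_continuousLinearMap (-z)
  have j3 := i3.integrable.apply_continuousLinearMap ν
  have hB : ∀ w : Space N, ∫ _ in Icc (0 : ℝ) 1, B w = B w := fun w => by simp
  simp only [sub_apply]
  rw [integral_add (μ := volume.restrict (Icc (0 : ℝ) 1))
      (f := fun s : ℝ => (c • G (x + (s • ε • ν - ε • z))) (-ν) - B (-ν) +
        ((c • G (x + (ε • ν - s • ε • z))) (-z) - B (-z)))
      (g := fun s : ℝ => (c • G (x + s • ε • ν)) ν - B ν)
      ((j1.sub (iB (-ν))).add (j2.sub (iB (-z)))) (j3.sub (iB ν)),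
    integral_add (μ := volume.restrict (Icc (0 : ℝ) 1))
      (f := fun s : ℝ => (c • G (x + (s • ε • ν - ε • z))) (-ν) - B (-ν))
      (g := fun s : ℝ => (c • G (x + (ε • ν - s • ε • z))) (-z) - B (-z))
      (j1.sub (iB (-ν))) (j2.sub (iB (-z))), integral_sub j1 (iB (-ν)),
    integral_sub j2 (iB (-z)), integral_sub j3 (iB ν), ← e1, ← e2, ← e3, hB, hB, hB]
  rw [p3]
  simp only [map_neg]
  module

theorem enorm_apply_le {A : Space N →L[ℝ] Space N} {w : Space N} {K : ℝ} (hw : ‖w‖ ≤ K) :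
    ‖A w‖ₑ ≤ ENNReal.ofReal K * ‖A‖ₑ := by
  have h : ‖A w‖ ≤ K * ‖A‖ :=
    (A.le_opNorm w).trans (by rw [mul_comm]; gcongr)
  rw [← ofReal_norm, ← ofReal_norm, ← ENNReal.ofReal_mul ((norm_nonneg w).trans hw)]
  exact ENNReal.ofReal_le_ofReal h

/-- Pointwise bound of the commutator error by the `shiftError`. -/
theorem ae_enorm_spatialCommutator_le {Ω : Opens (Space N)} {η : Space N → ℝ}
    (hη : ContDiff ℝ ∞ η) (hηs : tsupport η ⊆ Metric.closedBall 0 1) {L : ℝ}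
    (hL : ∀ z, ‖fderiv ℝ η z‖ ≤ L) {f : Space N → ℝ}
    (hf : ∀ x ∉ (Ω : Set (Space N)), f x = 0) {v : Space N → Space N}
    {G : Space N → (Space N →L[ℝ] Space N)} (hfm : StronglyMeasurable f)
    (hvm : StronglyMeasurable v)
    (hv : Integrable v volume) (hGm : StronglyMeasurable G) (hG : Integrable G volume)
    (hw : IsWeakDeriv Ω v G) (hdiv : IsDivFree Ω v) {A : Set (Space N)}
    (hAm : MeasurableSet A) (hAΩ : A ⊆ Ω) {ν : Space N} {ε : ℝ} (hε : 0 < ε)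
    (hA : HasInwardShift Ω A ν ε) :
    ∀ᵐ x ∂(volume.restrict A), ‖spatialCommutator Ω η v f ε x‖ₑ ≤
      ENNReal.ofReal L * ENNReal.ofReal (‖ν‖ + 1) *
        ∫⁻ w, shiftError f G ν ε x w ∂(segMeasure N) := by
  have hηc : HasCompactSupport η :=
    (isCompact_closedBall (0 : Space N) 1).of_isClosed_subset (isClosed_tsupport η) hηs
  refine (ae_restrict_iff' hAm).2 ?_
  filter_upwards [ae_ae_segmentIdentity hvm hv hGm hG hw hAm hA,
    hw.ae_trace_eq_zero hv hG hdiv] with x hx htr hxA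
  rw [spatialCommutator_eq_integral hη v hf hε]
  set g : Space N → ℝ :=
    fun z => f (x - ε • z) * fderiv ℝ η z (ε⁻¹ • (v (x - ε • z) - v x)) with hg
  set b : Space N → ℝ := fun z => fderiv ℝ η z ((f x • G x) z) with hb
  -- The divergence condition enters here: the formal limit has zero integral, so `b` can be added
  -- to the integrand for free.
  have hb0 : ∫ z, b z = 0 := by
    have : ∀ z, b z = f x * fderiv ℝ η z (G x z) := fun z => by simp [hb]
    simp only [this]
    rw [integral_const_mul, integral_fderiv_apply_linear hη hηc, htr (hAΩ hxA)]
    simp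
  have hbi : Integrable b volume := by
    refine Continuous.integrable_of_hasCompactSupport
      ((hη.continuous_fderiv (by simp)).clm_apply (f x • G x).continuous) ?_
    refine (hηc.fderiv (𝕜 := ℝ)).mono fun z hz => ?_
    contrapose! hz
    simp [hb, Function.notMem_support.1 hz]
  -- If `g` is not integrable, its Bochner integral is zero by convention and the bound is trivial.
  by_cases hgi : Integrable g volume
  swap
  · simp [integral_undef hgi]
  have hsum : ∫ z, g z = ∫ z, (g z + b z) := by rw [integral_add hgi hbi, hb0, add_zero]
  rw [hsum]
  refine (enorm_integral_le_lintegral_enorm _).trans ?_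
  have hoff : ∀ z ∉ Metric.closedBall (0 : Space N) 1, ‖g z + b z‖ₑ = 0 := by
    intro z hz
    have : fderiv ℝ η z = 0 :=
      image_eq_zero_of_notMem_tsupport fun h => hz (hηs (tsupport_fderiv_subset ℝ h))
    simp [hg, hb, this]
  have hmeas : Measurable (shiftError f G ν ε x) :=
    (measurable_shiftError hfm hGm ν ε).of_uncurry_left
  have hprod : ∫⁻ w, shiftError f G ν ε x w ∂(segMeasure N) =
      ∫⁻ z in Metric.closedBall 0 1, ∫⁻ s in Icc (0 : ℝ) 1, shiftError f G ν ε x (z, s) :=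
    lintegral_prod _ hmeas.aemeasurable
  have hmeas' : Measurable fun z => ∫⁻ s in Icc (0 : ℝ) 1, shiftError f G ν ε x (z, s) :=
    hmeas.lintegral_prod_right'
  have hball : ∫⁻ z, ‖g z + b z‖ₑ = ∫⁻ z in Metric.closedBall 0 1, ‖g z + b z‖ₑ :=
    (setLIntegral_eq_of_support_subset fun z hz => by_contra fun h => hz (hoff z h)).symm
  rw [hprod, hball, ← lintegral_const_mul _ hmeas']
  refine lintegral_mono_ae ?_
  refine (ae_restrict_iff' Metric.isClosed_closedBall.measurableSet).2 ?_
  filter_upwards [hx] with z hz hzb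
  have hz1 : ‖z‖ ≤ 1 := by simpa using hzb
  obtain ⟨s1, s2, s3⟩ := hz hxA hz1
  -- The third leg may leave `Ω` only when `x - ε z` is itself outside, and there `f` vanishes.
  have s3' : f (x - ε • z) = 0 ∨ SegmentIdentity v G (x - ε • z) (ε • ν) := by
    by_cases h : x - ε • z ∈ (Ω : Set (Space N))
    · exact Or.inr (s3 h)
    · exact Or.inl (hf _ h)
  have hkey := segment_difference hε (f x • G x) s1 s2 s3'
  have hgb : g z + b z = fderiv ℝ η z
      (f (x - ε • z) • ε⁻¹ • (v (x - ε • z) - v x) + (f x • G x) z) := by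
    simp [hg, hb]
  rw [hgb, hkey]
  have hLz : ∀ w : Space N, ‖fderiv ℝ η z w‖ₑ ≤ ENNReal.ofReal L * ‖w‖ₑ := by
    intro w
    have h : ‖fderiv ℝ η z w‖ ≤ L * ‖w‖ :=
      ((fderiv ℝ η z).le_opNorm w).trans (by gcongr; exact hL z)
    rw [← ofReal_norm, ← ofReal_norm, ← ENNReal.ofReal_mul ((norm_nonneg _).trans (hL z))]
    exact ENNReal.ofReal_le_ofReal h
  refine (hLz _).trans ?_
  rw [mul_assoc]
  refine mul_le_mul_right ((enorm_integral_le_lintegral_enorm _).trans ?_) _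
  have hmz : Measurable fun s => shiftError f G ν ε x (z, s) :=
    hmeas.comp measurable_prodMk_left
  rw [← lintegral_const_mul _ hmz]
  refine lintegral_mono fun s => ?_
  simp only [shiftError, mul_add (ENNReal.ofReal _), ← sub_eq_add_neg]
  -- The constant `‖ν‖ + 1` dominates the lengths of all three directions `-ν`, `-z`, `ν`.
  refine (enorm_add_le _ _).trans (add_le_add ((enorm_add_le _ _).trans (add_le_add ?_ ?_)) ?_)
  · exact enorm_apply_le (by rw [norm_neg]; linarith)
  · exact enorm_apply_le (by rw [norm_neg]; linarith [norm_nonneg ν])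
  · exact enorm_apply_le (by linarith)

end

/-! ### Existence of inward shifts near interior points and near a smooth boundary. -/

section

variable {N : ℕ}

/-- No shift is needed: from points in the half-radius ball, segments of length at most `ε < R / 2`
stay in the ball of radius `R` contained in `Ω`. -/
theorem exists_hasInwardShift_of_mem {Ω : Set (Space N)} (hΩ : IsOpen Ω) {x₀ : Space N}
    (hx₀ : x₀ ∈ Ω) : ∃ (ν : Space N) (r : ℝ), 0 < r ∧
      ∀ᶠ ε in 𝓝[>] (0 : ℝ), HasInwardShift Ω (Ω ∩ Metric.ball x₀ r) ν ε := by
  obtain ⟨R, hR, hball⟩ := Metric.isOpen_iff.1 hΩ x₀ hx₀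
  refine ⟨0, R / 2, by positivity, ?_⟩
  filter_upwards [Ioo_mem_nhdsGT (half_pos hR)] with ε hε x hx z hz s hs
  refine ⟨by simpa using hx.1, hball ?_, fun h => by simpa using h⟩
  have h1 : dist x x₀ < R / 2 := hx.2
  have h2 : ‖s • (ε • -z)‖ ≤ ε := by
    rw [norm_smul, norm_smul, norm_neg, Real.norm_of_nonneg hs.1, Real.norm_of_nonneg hε.1.le]
    calc s * (ε * ‖z‖) ≤ 1 * (ε * 1) := by
          have := hε.1
          gcongr
          exact hs.2
      _ = ε := by ring
  rw [Metric.mem_ball, dist_eq_norm] at *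
  calc ‖x + ε • (0 : Space N) + s • ε • -z - x₀‖ = ‖(x - x₀) + s • (ε • -z)‖ := by
        congr 1
        module
    _ ≤ ‖x - x₀‖ + ‖s • (ε • -z)‖ := norm_add_le _ _
    _ < R := by linarith [hε.2]

-- With `f` a local defining function, `ν` is a long multiple of a direction in which `f` decreases
-- at first order. Strict differentiability makes the linear approximation uniform over all pairs of
-- points near `x₀`, so one `ν` serves a whole neighbourhood, including the points `x - ε z`.
set_option maxHeartbeats 400000 in
theorem exists_hasInwardShift_of_mem_frontier {Ω : Set (Space N)} (hΩ : HasSmoothBoundary Ω)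
    {x₀ : Space N} (hx₀ : x₀ ∈ frontier Ω) : ∃ (ν : Space N) (r : ℝ), 0 < r ∧
      ∀ᶠ ε in 𝓝[>] (0 : ℝ), HasInwardShift Ω (Ω ∩ Metric.ball x₀ r) ν ε := by
  obtain ⟨U, hU, hxU, f, hf, -, hf', hfU⟩ := hΩ x₀ hx₀
  set D := fderiv ℝ f x₀ with hD
  have hstrict : HasStrictFDerivAt f D x₀ :=
    (hf.contDiffAt (hU.mem_nhds hxU)).hasStrictFDerivAt (by simp)
  obtain ⟨n, hn⟩ : ∃ n, D n ≠ 0 := by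
    by_contra! h
    exact hf' (ContinuousLinearMap.ext h)
  set w := (D n)⁻¹ • n with hw
  have hDw : D w = 1 := by simp [hw, hn]
  -- `c` is the admitted error of the linear approximation. The normalisation `c (‖w‖ + 1) = 1 / 2`
  -- yields both `c ‖w‖ ≤ 1 / 2` and `c ≤ 1 / 2`.
  set c : NNReal := ⟨1 / (2 * (‖w‖ + 1)), by positivity⟩ with hc
  have hc0 : 0 < c := by
    rw [← NNReal.coe_pos]
    change 0 < 1 / (2 * (‖w‖ + 1))
    positivity
  have hcw : (c : ℝ) * (‖w‖ + 1) = 1 / 2 := by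
    change 1 / (2 * (‖w‖ + 1)) * (‖w‖ + 1) = 1 / 2
    field_simp
  have hc1 : (c : ℝ) ≤ 1 / 2 := by nlinarith [norm_nonneg w, c.coe_nonneg]
  have hcw' : (c : ℝ) * ‖w‖ ≤ 1 / 2 := by nlinarith [norm_nonneg w, c.coe_nonneg]
  obtain ⟨V, hV, happ⟩ := hstrict.approximates_deriv_on_nhds (Or.inr hc0)
  obtain ⟨R, hR, hball⟩ := Metric.mem_nhds_iff.1 (Filter.inter_mem hV (hU.mem_nhds hxU))
  -- On the second segment the shift lowers `f` by `ε l`, the term in `z` costs at most `ε ‖D‖`, and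
  -- the approximation error at most `ε (l / 2 + 1 / 2)`. With this `l` a decrease of `ε / 2`
  -- remains.
  set l : ℝ := 2 * (‖D‖ + 1) with hl
  have hl0 : 0 < l := by positivity
  -- Near `x₀`, `f (x + h) ≤ f x + D h + c ‖h‖`, and belonging to `Ω` means that `f` is negative.
  have hdec : ∀ x h : Space N, x ∈ Metric.ball x₀ R → x + h ∈ Metric.ball x₀ R → x ∈ Ω →
      D h + c * ‖h‖ ≤ 0 → x + h ∈ Ω := by
    intro x h hx hxh hxΩ hh
    have h1 := happ (x + h) (hball hxh).1 x (hball hx).1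
    rw [add_sub_cancel_left] at h1
    have h2 := (abs_le.1 h1).2
    have h3 := (hfU x (hball hx).2).1 hxΩ
    exact (hfU _ (hball hxh).2).2 (by linarith)
  set ν : Space N := -(l • w) with hν
  have hDν : D ν = -l := by simp [hν, hDw]
  have hνn : ‖ν‖ = l * ‖w‖ := by rw [hν, norm_neg, norm_smul, Real.norm_of_nonneg hl0.le]
  clear_value ν
  refine ⟨ν, R / 2, by positivity, ?_⟩
  have hpos : 0 < R / 2 / (‖ν‖ + 1) := by positivity
  filter_upwards [Ioo_mem_nhdsGT hpos] with ε hε x hx z hz s hs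
  have hε0 : 0 < ε := hε.1
  have hεR : ε * (‖ν‖ + 1) < R / 2 := (lt_div_iff₀ (by positivity)).1 hε.2
  have hx1 : ‖x - x₀‖ < R / 2 := by
    have := hx.2
    rwa [Metric.mem_ball, dist_eq_norm] at this
  have hmem : ∀ h : Space N, ‖h‖ ≤ ε * (‖ν‖ + 1) → x + h ∈ Metric.ball x₀ R := by
    intro h hh
    rw [Metric.mem_ball, dist_eq_norm, add_sub_right_comm]
    linarith [norm_add_le (x - x₀) h]
  have hxR : x ∈ Metric.ball x₀ R := by simpa using hmem 0 (by simp; positivity)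
  have hz' : ‖ε • z‖ ≤ ε := by
    rw [norm_smul, Real.norm_of_nonneg hε0.le]
    nlinarith
  have hν' : ‖s • (ε • ν)‖ = s * (ε * ‖ν‖) := by
    rw [norm_smul, norm_smul, Real.norm_of_nonneg hs.1, Real.norm_of_nonneg hε0.le]
  have hν'' : ‖s • (ε • ν)‖ ≤ ε * ‖ν‖ := by
    rw [hν']
    have : 0 ≤ ε * ‖ν‖ := by positivity
    nlinarith [hs.2]
  have hneg : D (s • (ε • ν)) + c * ‖s • (ε • ν)‖ ≤ 0 := by
    rw [hν', map_smul, map_smul, hDν, hνn]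
    simp only [smul_eq_mul]
    have h1 : s * (ε * -l) + c * (s * (ε * (l * ‖w‖))) = s * ε * l * (c * ‖w‖ - 1) := by ring
    rw [h1]
    have : 0 ≤ s * ε * l := mul_nonneg (mul_nonneg hs.1 hε0.le) hl0.le
    nlinarith
  refine ⟨?_, ?_, fun hxz => ?_⟩
  · exact hdec x _ hxR (hmem _ (by nlinarith)) hx.1 hneg
  · rw [add_assoc]
    have hn1 : ‖ε • ν + s • (ε • -z)‖ ≤ ε * (‖ν‖ + 1) := by
      refine (norm_add_le _ _).trans ?_
      rw [smul_neg, smul_neg, norm_neg, norm_smul s, norm_smul ε ν, Real.norm_of_nonneg hs.1,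
        Real.norm_of_nonneg hε0.le]
      nlinarith [hs.2, hs.1, norm_nonneg (ε • z)]
    refine hdec x _ hxR (hmem _ hn1) hx.1 ?_
    have hDz : |D z| ≤ ‖D‖ := by
      have := D.le_opNorm z
      rw [Real.norm_eq_abs] at this
      nlinarith [norm_nonneg D]
    have hDz' : -(s * D z) ≤ ‖D‖ := by
      have h2 := abs_le.1 hDz
      nlinarith [hs.1, hs.2, norm_nonneg D]
    have hcn : (c : ℝ) * ‖ε • ν + s • (ε • -z)‖ ≤ c * (ε * (‖ν‖ + 1)) := by gcongr
    rw [map_add, map_smul, map_smul, map_smul, map_neg, hDν]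
    simp only [smul_eq_mul]
    have h4 : (c : ℝ) * (ε * (‖ν‖ + 1)) ≤ ε * (l / 2 + 1 / 2) := by
      rw [hνn]
      have : (c : ℝ) * (ε * (l * ‖w‖ + 1)) = ε * (l * (c * ‖w‖) + c) := by ring
      rw [this]
      have h5 := mul_le_mul_of_nonneg_left hcw' hl0.le
      exact mul_le_mul_of_nonneg_left (by linarith) hε0.le
    have h5 : ε * -l + s * (ε * -(D z)) = ε * (-l + -(s * D z)) := by ring
    rw [h5]
    have h6 : ε * (-l + -(s * D z)) ≤ ε * (-l + ‖D‖) := by gcongr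
    have h7 : ε * (-l + ‖D‖) + ε * (l / 2 + 1 / 2) = ε * (-(1 / 2)) := by
      rw [hl]
      ring
    linarith
  · have hxz' : x - ε • z ∈ Metric.ball x₀ R := by
      rw [sub_eq_add_neg]
      refine hmem _ ?_
      rw [norm_neg]
      nlinarith [mul_nonneg hε0.le (norm_nonneg ν)]
    refine hdec _ _ hxz' ?_ hxz hneg
    rw [sub_eq_add_neg, add_assoc]
    refine hmem _ ((norm_add_le _ _).trans ?_)
    rw [norm_neg]
    linarith

end

/-! ### The `L^γ` estimate of the commutator at a fixed time. -/

section

variable {N : ℕ}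

/-- Extension by zero makes translates available on the whole space without changing any Lebesgue
norm; strong measurability makes the segment integrals measurable at every point. -/
theorem exists_stronglyMeasurable_representative {F : Type*} [NormedAddCommGroup F]
    {Ω : Set (Space N)} (hΩ : MeasurableSet Ω) {f : Space N → F}
    (hf : AEStronglyMeasurable f (volume.restrict Ω)) :
    ∃ f' : Space N → F, StronglyMeasurable f' ∧ (∀ x ∉ Ω, f' x = 0) ∧
      f =ᵐ[volume.restrict Ω] f' ∧
        ∀ r, eLpNorm f' r volume = eLpNorm f r (volume.restrict Ω) := by
  have h : f =ᵐ[volume.restrict Ω] Ω.indicator (hf.mk f) :=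
    hf.ae_eq_mk.trans (indicator_ae_eq_restrict hΩ).symm
  refine ⟨Ω.indicator (hf.mk f), hf.stronglyMeasurable_mk.indicator hΩ,
    fun x hx => indicator_of_notMem hx _, h, fun r => ?_⟩
  rw [eLpNorm_indicator_eq_eLpNorm_restrict hΩ, eLpNorm_congr_ae hf.ae_eq_mk]

theorem spatialCommutator_congr {Ω : Set (Space N)} (η : Space N → ℝ)
    {f f' : Space N → ℝ} {v v' : Space N → Space N} (hf : f =ᵐ[volume.restrict Ω] f')
    (hv : v =ᵐ[volume.restrict Ω] v') (ε : ℝ) :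
    spatialCommutator Ω η v f ε =ᵐ[volume.restrict Ω] spatialCommutator Ω η v' f' ε := by
  filter_upwards [hv] with x hx
  refine integral_congr_ae ?_
  filter_upwards [hf, hv] with y hfy hvy
  rw [hx, hfy, hvy]

theorem IsWeakDeriv.congr {Ω : Opens (Space N)} {v v' : Space N → Space N}
    {G G' : Space N → (Space N →L[ℝ] Space N)} (hw : IsWeakDeriv Ω v G)
    (hv : v =ᵐ[volume.restrict (Ω : Set (Space N))] v')
    (hG : G =ᵐ[volume.restrict (Ω : Set (Space N))] G') : IsWeakDeriv Ω v' G' := by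
  intro ψ e
  have h1 : ∫ x in (Ω : Set (Space N)), (fderiv ℝ (⇑ψ) x e) • v x =
      ∫ x in (Ω : Set (Space N)), (fderiv ℝ (⇑ψ) x e) • v' x :=
    integral_congr_ae (hv.mono fun x hx => by simp only [hx])
  have h2 : ∫ x in (Ω : Set (Space N)), ψ x • G x e =
      ∫ x in (Ω : Set (Space N)), ψ x • G' x e :=
    integral_congr_ae (hG.mono fun x hx => by simp only [hx])
  rw [← h1, ← h2]
  exact hw ψ e

theorem IsDivFree.congr {Ω : Opens (Space N)} {v v' : Space N → Space N} (hd : IsDivFree Ω v)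
    (hv : v =ᵐ[volume.restrict (Ω : Set (Space N))] v') : IsDivFree Ω v' := by
  intro ψ
  rw [← hd ψ]
  exact integral_congr_ae (hv.mono fun x hx => by simp only [hx])

/-- If the products of `ε`-translates of `f` and `G` deviate from `f G` by at most `δ` in
`L^γ`, then the commutator error is at most a multiple of `δ` in `L^γ`. -/
theorem eLpNorm_spatialCommutator_le {Ω : Opens (Space N)} {η : Space N → ℝ}
    (hη : ContDiff ℝ ∞ η) (hηs : tsupport η ⊆ Metric.closedBall 0 1) {L : ℝ}
    (hL : ∀ z, ‖fderiv ℝ η z‖ ≤ L) {f : Space N → ℝ}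
    (hf : ∀ x ∉ (Ω : Set (Space N)), f x = 0) {v : Space N → Space N}
    {G : Space N → (Space N →L[ℝ] Space N)} (hfm : StronglyMeasurable f)
    (hvm : StronglyMeasurable v)
    (hv : Integrable v volume) (hGm : StronglyMeasurable G) (hG : Integrable G volume)
    (hw : IsWeakDeriv Ω v G) (hdiv : IsDivFree Ω v) {A : Set (Space N)}
    (hAm : MeasurableSet A) (hAΩ : A ⊆ Ω) {ν : Space N} {ε : ℝ} (hε : 0 < ε)
    (hA : HasInwardShift Ω A ν ε) {γ : ℝ≥0∞} (hγ : 1 ≤ γ) (hγ' : γ ≠ ⊤) {δ : ℝ≥0∞}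
    (hδ : ∀ h k : Space N, ‖h‖ ≤ ε * (‖ν‖ + 1) → ‖k‖ ≤ ε * (‖ν‖ + 1) →
      eLpNorm (fun x => f (x + h) • G (x + k) - f x • G x) γ volume ≤ δ) :
    eLpNorm (spatialCommutator Ω η v f ε) γ (volume.restrict A) ≤
      ENNReal.ofReal L * ENNReal.ofReal (‖ν‖ + 1) * (segMeasure N univ * (3 * δ)) := by
  refine eLpNorm_le_of_enorm_le_lintegral hγ hγ' (measurable_shiftError hfm hGm ν ε)
    (ae_enorm_spatialCommutator_le hη hηs hL hf hfm hvm hv hGm hG hw hdiv hAm hAΩ hε hA) ?_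
  have hae : ∀ᵐ w ∂(segMeasure N), w ∈ Metric.closedBall (0 : Space N) 1 ×ˢ Icc (0 : ℝ) 1 := by
    rw [segMeasure, Measure.prod_restrict]
    exact ae_restrict_mem (Metric.isClosed_closedBall.measurableSet.prod measurableSet_Icc)
  filter_upwards [hae] with w hw
  obtain ⟨z, s⟩ := w
  have hz : ‖z‖ ≤ 1 := by simpa using hw.1
  have hs : s ∈ Icc (0 : ℝ) 1 := hw.2
  have n1 : ‖ε • z‖ ≤ ε := by
    rw [norm_smul, Real.norm_of_nonneg hε.le]
    nlinarith
  have hsm : ∀ w : Space N, ‖s • w‖ ≤ ‖w‖ := fun w => by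
    rw [norm_smul, Real.norm_of_nonneg hs.1]
    exact mul_le_of_le_one_left (norm_nonneg w) hs.2
  have n2 : ‖ε • ν‖ = ε * ‖ν‖ := by rw [norm_smul, Real.norm_of_nonneg hε.le]
  have n3 : 0 ≤ ε * ‖ν‖ := by positivity
  have hm : ∀ h k : Space N,
      AEStronglyMeasurable (fun x => f (x + h) • G (x + k) - f x • G x) volume := fun h k =>
    (((hfm.comp_measurable (measurable_add_const h)).smul
      (hGm.comp_measurable (measurable_add_const k))).sub (hfm.smul hGm)).aestronglyMeasurable
  have hm' : ∀ h k : Space N, AEStronglyMeasurable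
      (fun x => ‖f (x + h) • G (x + k) - f x • G x‖ₑ) (volume.restrict A) := fun h k =>
    (hm h k).restrict.enorm.aestronglyMeasurable
  have hb : ∀ h k : Space N, ‖h‖ ≤ ε * (‖ν‖ + 1) → ‖k‖ ≤ ε * (‖ν‖ + 1) →
      eLpNorm (fun x => ‖f (x + h) • G (x + k) - f x • G x‖ₑ) γ (volume.restrict A) ≤ δ := by
    intro h k hh hk
    rw [eLpNorm_enorm]
    exact (eLpNorm_mono_measure _ Measure.restrict_le_self).trans (hδ h k hh hk)
  have b0 : ‖-(ε • z)‖ ≤ ε * (‖ν‖ + 1) := by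
    rw [norm_neg]
    linarith
  have b1 : ‖s • ε • ν - ε • z‖ ≤ ε * (‖ν‖ + 1) := by
    linarith [norm_sub_le (s • ε • ν) (ε • z), hsm (ε • ν)]
  have b2 : ‖ε • ν - s • ε • z‖ ≤ ε * (‖ν‖ + 1) := by
    linarith [norm_sub_le (ε • ν) (s • ε • z), hsm (ε • z)]
  have b3 : ‖s • ε • ν‖ ≤ ε * (‖ν‖ + 1) := by
    linarith [hsm (ε • ν)]
  calc eLpNorm (fun x => shiftError f G ν ε x (z, s)) γ (volume.restrict A) ≤ δ + δ + δ :=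
        (eLpNorm_add_le ((hm' _ _).add (hm' _ _)) (hm' _ _) hγ).trans
          (add_le_add ((eLpNorm_add_le (hm' _ _) (hm' _ _) hγ).trans
            (add_le_add (hb _ _ b0 b1) (hb _ _ b0 b2))) (hb _ _ b0 b3))
    _ = 3 * δ := by ring

/-- The hypotheses on the density and the velocity field at a fixed time. -/
structure IsTimeSlice (Ω : Opens (Space N)) (p α : ℝ≥0∞) (v : Space N → Space N)
    (G : Space N → (Space N →L[ℝ] Space N)) (f : Space N → ℝ) : Prop where
  density : MemLp f p (volume.restrict (Ω : Set (Space N)))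
  velocity : MemLp v α (volume.restrict (Ω : Set (Space N)))
  gradient : MemLp G α (volume.restrict (Ω : Set (Space N)))
  weakDeriv : IsWeakDeriv Ω v G
  divFree : IsDivFree Ω v

/-- A uniform bound and the limit of the commutator error at a fixed time. -/
theorem IsTimeSlice.commutator_estimate {Ω : Opens (Space N)}
    (hΩ : Bornology.IsBounded (Ω : Set (Space N))) {η : Space N → ℝ}
    (hη : ContDiff ℝ ∞ η) (hηs : tsupport η ⊆ Metric.closedBall 0 1) {L : ℝ}
    (hL : ∀ z, ‖fderiv ℝ η z‖ ≤ L) {p α γ : ℝ≥0∞} [ht : ENNReal.HolderTriple p α γ]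
    (hp : 1 ≤ p) (hα : 1 ≤ α) (hγ : 1 ≤ γ) (hγ' : γ ≠ ⊤)
    {v : Space N → Space N} {G : Space N → (Space N →L[ℝ] Space N)} {f : Space N → ℝ}
    (hs : IsTimeSlice Ω p α v G f) {A : Set (Space N)}
    (hAm : MeasurableSet A) (hAΩ : A ⊆ Ω) {ν : Space N}
    (hA : ∀ᶠ ε in 𝓝[>] (0 : ℝ), HasInwardShift Ω A ν ε) :
    (∀ ε : ℝ, 0 < ε → HasInwardShift Ω A ν ε →
      eLpNorm (spatialCommutator Ω η v f ε) γ (volume.restrict A) ≤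
        ENNReal.ofReal L * ENNReal.ofReal (‖ν‖ + 1) * (segMeasure N univ *
          (3 * (2 * (eLpNorm f p (volume.restrict (Ω : Set (Space N))) *
            eLpNorm G α (volume.restrict (Ω : Set (Space N)))))))) ∧
    Tendsto (fun ε => eLpNorm (spatialCommutator Ω η v f ε) γ (volume.restrict A))
      (𝓝[>] 0) (𝓝 0) := by
  have hΩm := Ω.isOpen.measurableSet
  have hfin : IsFiniteMeasure (volume.restrict (Ω : Set (Space N))) :=
    ⟨by simpa using hΩ.measure_lt_top⟩
  obtain ⟨f', hfm, hf0, hff, hfn⟩ := exists_stronglyMeasurable_representative hΩm hs.density.1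
  obtain ⟨v', hvm, -, hvv, hvn⟩ := exists_stronglyMeasurable_representative hΩm hs.velocity.1
  obtain ⟨G', hGm, -, hGG, hGn⟩ := exists_stronglyMeasurable_representative hΩm hs.gradient.1
  have hw := hs.weakDeriv.congr hvv hGG
  have hd := hs.divFree.congr hvv
  have hcongr : ∀ ε, eLpNorm (spatialCommutator Ω η v f ε) γ (volume.restrict A) =
      eLpNorm (spatialCommutator Ω η v' f' ε) γ (volume.restrict A) := fun ε =>
    eLpNorm_congr_ae (ae_restrict_of_ae_restrict_of_subset hAΩ
      (spatialCommutator_congr η hff hvv ε))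
  have hv1 : Integrable v' volume := memLp_one_iff_integrable.1
    ⟨hvm.aestronglyMeasurable, by rw [hvn]; exact (hs.velocity.mono_exponent hα).2⟩
  have hG1 : Integrable G' volume := memLp_one_iff_integrable.1
    ⟨hGm.aestronglyMeasurable, by rw [hGn]; exact (hs.gradient.mono_exponent hα).2⟩
  have hfp : MemLp f' p volume := ⟨hfm.aestronglyMeasurable, by rw [hfn]; exact hs.density.2⟩
  have hGα : MemLp G' α volume := ⟨hGm.aestronglyMeasurable, by rw [hGn]; exact hs.gradient.2⟩
  have hγp : γ ≤ p := by
    rw [← ENNReal.inv_le_inv, ← ht.inv_add_inv_eq_inv]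
    exact le_self_add
  have hfγ : MemLp f' γ volume :=
    ⟨hfm.aestronglyMeasurable, by rw [hfn]; exact (hs.density.mono_exponent hγp).2⟩
  have key := fun ε (hε : 0 < ε) (hAε : HasInwardShift Ω A ν ε) δ =>
    eLpNorm_spatialCommutator_le (ε := ε) (δ := δ) hη hηs hL hf0 hfm hvm hv1 hGm hG1 hw hd
      hAm hAΩ hε hAε hγ hγ'
  refine ⟨fun ε hε hAε => ?_, ?_⟩
  · rw [hcongr, ← hfn, ← hGn]
    -- This bound on products of translates holds for all `h`, `k`, hence uniformly in `ε`. It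
    -- supplies the dominating function in time.
    exact key ε hε hAε _ fun h k _ _ => eLpNorm_translate_smul_sub_le hγ hfp hGα h k
  · simp only [hcongr]
    set C := ENNReal.ofReal L * ENNReal.ofReal (‖ν‖ + 1) * (segMeasure N univ * 3) with hC
    have hCtop : C ≠ ⊤ := by
      refine ENNReal.mul_ne_top (ENNReal.mul_ne_top (by simp) (by simp))
        (ENNReal.mul_ne_top (measure_ne_top _ _) (by simp))
    refine ENNReal.tendsto_nhds_zero.2 fun κ hκ => ?_
    have hδ : 0 < κ / (C + 1) :=
      ENNReal.div_pos_iff.2 ⟨hκ.ne', by simp [hCtop]⟩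
    obtain ⟨R, hR, hball⟩ := Metric.eventually_nhds_iff.1 (ENNReal.tendsto_nhds_zero.1
      (tendsto_eLpNorm_translate_smul_sub hp hγ hγ' hfp hfγ hGα) _ hδ)
    have hpos : 0 < R / (‖ν‖ + 1) := by positivity
    filter_upwards [hA, Ioo_mem_nhdsGT hpos] with ε hAε hε
    have hεR : ε * (‖ν‖ + 1) < R := (lt_div_iff₀ (by positivity)).1 hε.2
    refine (key ε hε.1 hAε (κ / (C + 1)) fun h k hh hk => ?_).trans ?_
    · refine hball (y := (h, k)) ?_
      rw [dist_zero_right, Prod.norm_def]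
      exact (max_le hh hk).trans_lt hεR
    · calc _ = C * (κ / (C + 1)) := by rw [hC]; ring
        _ ≤ (C + 1) * (κ / (C + 1)) := by gcongr; exact le_self_add
        _ ≤ κ := ENNReal.mul_div_le

end

/-! ### Measurability in time, and integrability over time and two space variables. -/

section

variable {N : ℕ}

/-- For finite exponents this is Tonelli. For `α = ∞` there is no integral formula; instead, the
norm exceeds `c` exactly when the slice of a measurable set has positive measure. -/
theorem aemeasurable_eLpNorm_slice {F X Y : Type*} [NormedAddCommGroup F] [MeasurableSpace X]
    [MeasurableSpace Y] {τ : Measure X} {μ : Measure Y} [SFinite μ] {f : X → Y → F}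
    (hf : AEStronglyMeasurable (Function.uncurry f) (τ.prod μ)) (α : ℝ≥0∞) :
    AEMeasurable (fun t => eLpNorm (f t) α μ) τ := by
  set g : X → Y → F := fun t x => hf.mk _ (t, x) with hg
  have hgm : StronglyMeasurable (Function.uncurry g) := hf.stronglyMeasurable_mk
  have hfg : (fun t => eLpNorm (f t) α μ) =ᵐ[τ] fun t => eLpNorm (g t) α μ := by
    filter_upwards [Measure.ae_ae_of_ae_prod hf.ae_eq_mk] with t ht
    exact eLpNorm_congr_ae ht
  refine (Measurable.aemeasurable ?_).congr hfg.symm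
  rcases eq_or_ne α 0 with rfl | h0
  · simp
  rcases eq_or_ne α ⊤ with rfl | htop
  · refine measurable_of_Ioi fun c => ?_
    have hset : (fun t => eLpNorm (g t) ⊤ μ) ⁻¹' Ioi c =
        {t | μ (Prod.mk t ⁻¹' {z : X × Y | c < ‖Function.uncurry g z‖ₑ}) = 0}ᶜ := by
      ext t
      rw [mem_preimage, mem_Ioi, ← not_le, mem_compl_iff]
      refine not_congr ?_
      have : (μ (Prod.mk t ⁻¹' {z : X × Y | c < ‖Function.uncurry g z‖ₑ}) = 0) ↔
          ∀ᵐ x ∂μ, ‖g t x‖ₑ ≤ c := by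
        rw [ae_iff]
        simp only [not_le]
        rfl
      refine Iff.trans ?_ this.symm
      rw [eLpNorm_exponent_top]
      exact ⟨fun h => (ae_le_eLpNormEssSup).mono fun x hx => hx.trans h,
        fun h => essSup_le_of_ae_le c h⟩
    rw [hset]
    exact (measurable_measure_prodMk_left (measurableSet_lt measurable_const hgm.enorm)
      (measurableSet_singleton 0)).compl
  · simp only [eLpNorm_eq_lintegral_rpow_enorm_toReal h0 htop]
    exact ((hgm.enorm.pow_const α.toReal).lintegral_prod_right').pow_const _

theorem exists_eLpNorm_le_const_mul {F Y : Type*} [NormedAddCommGroup F] [MeasurableSpace Y]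
    (μ : Measure Y) [IsFiniteMeasure μ] {r s : ℝ≥0∞} (hr : r ≠ 0) (hrs : r ≤ s) :
    ∃ c : ℝ≥0∞, c ≠ ⊤ ∧ ∀ f : Y → F, AEStronglyMeasurable f μ →
      eLpNorm f r μ ≤ c * eLpNorm f s μ := by
  refine ⟨μ univ ^ (1 / r.toReal - 1 / s.toReal), ?_, fun f hf => ?_⟩
  · refine ENNReal.rpow_ne_top_of_nonneg ?_ (measure_ne_top μ univ)
    rcases eq_or_ne s ⊤ with rfl | hs
    · simp
    have : r.toReal ≤ s.toReal := ENNReal.toReal_mono hs hrs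
    have h0 : 0 < r.toReal := ENNReal.toReal_pos hr (ne_top_of_le_ne_top hs hrs)
    exact sub_nonneg.2 (one_div_le_one_div_of_le h0 this)
  · rw [mul_comm]
    exact eLpNorm_le_eLpNorm_mul_rpow_measure_univ hrs hf

/-- Integrability of `h(t,y) k(t,x)` on `(0,T) × Ω × Ω`. -/
theorem integrable_bilin_slices {F₁ F₂ F₃ X Y : Type*} [NormedAddCommGroup F₁]
    [NormedAddCommGroup F₂] [NormedAddCommGroup F₃] [NormedSpace ℝ F₁] [NormedSpace ℝ F₂]
    [NormedSpace ℝ F₃] [MeasurableSpace X]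
    [MeasurableSpace Y] {τ : Measure X} {μ : Measure Y} [SFinite τ] [SFinite μ]
    (B : F₁ →L[ℝ] F₂ →L[ℝ] F₃) {h : X → Y → F₁}
    {k : X → Y → F₂} (hh : AEStronglyMeasurable (Function.uncurry h) (τ.prod μ))
    (hk : AEStronglyMeasurable (Function.uncurry k) (τ.prod μ))
    (hfin : ∫⁻ t, eLpNorm (h t) 1 μ * eLpNorm (k t) 1 μ ∂τ < ⊤) :
    Integrable (fun z : (X × Y) × Y => B (h z.1.1 z.2) (k z.1.1 z.1.2)) ((τ.prod μ).prod μ) := by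
  have hq : Measure.QuasiMeasurePreserving (fun z : (X × Y) × Y => (z.1.1, z.2))
      ((τ.prod μ).prod μ) (τ.prod μ) :=
    QuasiMeasurePreserving.prodMap Measure.quasiMeasurePreserving_fst
      (Measure.QuasiMeasurePreserving.id μ)
  have h1 : AEStronglyMeasurable (fun z : (X × Y) × Y => h z.1.1 z.2) ((τ.prod μ).prod μ) :=
    hh.comp_quasiMeasurePreserving hq
  have h2 : AEStronglyMeasurable (fun z : (X × Y) × Y => k z.1.1 z.1.2) ((τ.prod μ).prod μ) :=
    hk.comp_fst
  refine ⟨B.aestronglyMeasurable_comp₂ h1 h2, ?_⟩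
  have h3 : ∀ z : (X × Y) × Y, ‖B (h z.1.1 z.2) (k z.1.1 z.1.2)‖ₑ ≤
      ‖B‖ₑ * (‖k z.1.1 z.1.2‖ₑ * ‖h z.1.1 z.2‖ₑ) := by
    intro z
    rw [mul_comm ‖k _ _‖ₑ, ← mul_assoc, ← ofReal_norm, ← ofReal_norm, ← ofReal_norm,
      ← ofReal_norm, ← ENNReal.ofReal_mul (norm_nonneg _), ← ENNReal.ofReal_mul (by positivity)]
    exact ENNReal.ofReal_le_ofReal (B.le_opNorm₂ _ _)
  refine (lintegral_mono h3).trans_lt ?_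
  rw [lintegral_const_mul' _ _ (by simp)]
  refine ENNReal.mul_lt_top (by simp) ?_
  have hm : AEMeasurable (fun z : (X × Y) × Y => ‖k z.1.1 z.1.2‖ₑ * ‖h z.1.1 z.2‖ₑ)
      ((τ.prod μ).prod μ) := h2.enorm.mul h1.enorm
  rw [lintegral_prod _ hm, lintegral_prod _ hm.lintegral_prod_right']
  refine (lintegral_mono_ae ?_).trans_lt hfin
  filter_upwards [hh.prodMk_left, hk.prodMk_left] with t ht ht'
  have e1 : ∀ x, ∫⁻ y, ‖k t x‖ₑ * ‖h t y‖ₑ ∂μ = ‖k t x‖ₑ * ∫⁻ y, ‖h t y‖ₑ ∂μ := fun x =>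
    lintegral_const_mul'' _ ht.enorm
  simp only [e1, eLpNorm_one_eq_lintegral_enorm]
  have e2 : AEMeasurable (fun x => ‖k t x‖ₑ) μ := ht'.enorm
  rw [lintegral_mul_const'' _ e2, mul_comm]

theorem integrable_bdd_clm_apply {X F₁ F₂ : Type*} [MeasurableSpace X] [NormedAddCommGroup F₁]
    [NormedAddCommGroup F₂] [NormedSpace ℝ F₁] [NormedSpace ℝ F₂] {μ : Measure X}
    {A : X → F₁ →L[ℝ] F₂} {g : X → F₁} {C : ℝ} (hA : AEStronglyMeasurable A μ)
    (hC : ∀ x, ‖A x‖ ≤ C) (hg : Integrable g μ) : Integrable (fun x => A x (g x)) μ := by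
  refine (hg.norm.const_mul C).mono'
    ((ContinuousLinearMap.id ℝ (F₁ →L[ℝ] F₂)).aestronglyMeasurable_comp₂ hA hg.1)
    (Eventually.of_forall fun x => ?_)
  exact ((A x).le_opNorm _).trans (by gcongr; exact hC x)

theorem hasCompactSupport_kernel {η : Space N → ℝ}
    (hηs : tsupport η ⊆ Metric.closedBall 0 1) {ε : ℝ} (hε : 0 < ε) :
    HasCompactSupport (kernel η ε) := by
  refine HasCompactSupport.intro (isCompact_closedBall (0 : Space N) ε) fun x hx => ?_
  have : ε⁻¹ • x ∉ tsupport η := fun h => hx (by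
    have h1 := hηs h
    rw [mem_closedBall_zero_iff, norm_smul, norm_inv, Real.norm_of_nonneg hε.le] at h1
    rw [mem_closedBall_zero_iff]
    rwa [inv_mul_le_iff₀ hε, mul_one] at h1)
  simp [kernel, image_eq_zero_of_notMem_tsupport this]

theorem kernel_eq_zero {η : Space N → ℝ}
    (hηs : tsupport η ⊆ Metric.closedBall 0 1) {ε : ℝ} (hε : 0 < ε) {x : Space N}
    (hx : ε < ‖x‖) : kernel η ε x = 0 := by
  have : ε⁻¹ • x ∉ tsupport η := fun h => hx.not_ge (by
    have h1 := hηs h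
    rw [mem_closedBall_zero_iff, norm_smul, norm_inv, Real.norm_of_nonneg hε.le] at h1
    rwa [inv_mul_le_iff₀ hε, mul_one] at h1)
  simp [kernel, image_eq_zero_of_notMem_tsupport this]

/-- Integral bounds for the density `ρ` and the velocity field `u` that make the commutator
integrable. -/
structure HasIntegralBounds {X : Type*} [MeasurableSpace X] (τ : Measure X)
    (μ : Measure (Space N)) (u : X → Space N → Space N) (ρ : X → Space N → ℝ) : Prop where
  aesm_density : AEStronglyMeasurable (Function.uncurry ρ) (τ.prod μ)
  aesm_velocity : AEStronglyMeasurable (Function.uncurry u) (τ.prod μ)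
  density : ∃ M : ℝ≥0∞, M ≠ ⊤ ∧ ∀ᵐ t ∂τ, eLpNorm (ρ t) 1 μ ≤ M
  velocity : ∫⁻ t, eLpNorm (u t) 1 μ ∂τ < ⊤
  flux : ∫⁻ t, eLpNorm (fun x => ρ t x • u t x) 1 μ ∂τ < ⊤

section Bounds

variable {X : Type*} [MeasurableSpace X] {τ : Measure X} {μ : Measure (Space N)}
  [IsFiniteMeasure τ] {u : X → Space N → Space N} {ρ : X → Space N → ℝ}

theorem HasIntegralBounds.lintegral_density (hb : HasIntegralBounds τ μ u ρ) :
    ∫⁻ t, eLpNorm (ρ t) 1 μ ∂τ < ⊤ := by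
  obtain ⟨M, hM, hM'⟩ := hb.density
  refine (lintegral_mono_ae hM').trans_lt ?_
  rw [lintegral_const]
  exact ENNReal.mul_lt_top hM.lt_top (measure_lt_top _ _)

variable [IsFiniteMeasure μ]

theorem HasIntegralBounds.integrable_density (hb : HasIntegralBounds τ μ u ρ) :
    Integrable (fun z : (X × Space N) × Space N => ρ z.1.1 z.2) ((τ.prod μ).prod μ) := by
  -- The constant second factor supplies the idle variable `x`; finiteness of `μ` makes it
  -- integrable.
  have h := integrable_bilin_slices (ContinuousLinearMap.mul ℝ ℝ)
    (k := fun _ _ => (1 : ℝ)) hb.aesm_density aestronglyMeasurable_const (by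
      rw [lintegral_mul_const' _ _ (by
        rw [eLpNorm_const' _ (by simp) (by simp)]
        exact ENNReal.mul_ne_top (by simp) (by simp))]
      exact ENNReal.mul_lt_top hb.lintegral_density (by
        rw [eLpNorm_const' _ (by simp) (by simp)]
        exact (ENNReal.mul_ne_top (by simp) (by simp)).lt_top))
  simpa using h

theorem HasIntegralBounds.integrable_flux (hb : HasIntegralBounds τ μ u ρ) :
    Integrable (fun z : (X × Space N) × Space N => ρ z.1.1 z.2 • u z.1.1 z.2)
      ((τ.prod μ).prod μ) := by
  have h := integrable_bilin_slices (h := fun t x => ρ t x • u t x)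
    (ContinuousLinearMap.lsmul ℝ ℝ : ℝ →L[ℝ] Space N →L[ℝ] Space N).flip
    (k := fun _ _ => (1 : ℝ)) (hb.aesm_density.smul hb.aesm_velocity)
    aestronglyMeasurable_const (by
      rw [lintegral_mul_const' _ _ (by
        rw [eLpNorm_const' _ (by simp) (by simp)]
        exact ENNReal.mul_ne_top (by simp) (by simp))]
      exact ENNReal.mul_lt_top hb.flux (by
        rw [eLpNorm_const' _ (by simp) (by simp)]
        exact (ENNReal.mul_ne_top (by simp) (by simp)).lt_top))
  simpa using h

/-- Density and velocity are taken at different points, so no Hölder pairing is needed: an `L^1`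
bound on `ρ(t)` uniform in time suffices against `∫ ‖u(t)‖_1 dt`. -/
theorem HasIntegralBounds.integrable_cross (hb : HasIntegralBounds τ μ u ρ) :
    Integrable (fun z : (X × Space N) × Space N => ρ z.1.1 z.2 • u z.1.1 z.1.2)
      ((τ.prod μ).prod μ) := by
  obtain ⟨M, hM, hM'⟩ := hb.density
  refine integrable_bilin_slices
    (ContinuousLinearMap.lsmul ℝ ℝ : ℝ →L[ℝ] Space N →L[ℝ] Space N)
    hb.aesm_density hb.aesm_velocity ?_
  calc _ ≤ ∫⁻ t, M * eLpNorm (u t) 1 μ ∂τ :=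
        lintegral_mono_ae (hM'.mono fun t ht => mul_le_mul_left ht _)
    _ < ⊤ := by
        rw [lintegral_const_mul' _ _ hM]
        exact ENNReal.mul_lt_top hM.lt_top hb.velocity

end Bounds

section Kernel

variable {X : Type*} [MeasurableSpace X] {τ : Measure X} {Ω : Set (Space N)}
  {u : X → Space N → Space N} {ρ : X → Space N → ℝ}
  {η : Space N → ℝ} {ε : ℝ}

theorem continuous_fderiv_kernel_sub (hη : ContDiff ℝ ∞ η) (ε : ℝ) :
    Continuous fun w : Space N × Space N =>
      fderiv ℝ (fun z => kernel η ε (z - w.2)) w.1 := by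
  have h : ∀ w : Space N × Space N, fderiv ℝ (fun z => kernel η ε (z - w.2)) w.1 =
      fderiv ℝ (kernel η ε) (w.1 - w.2) := fun w => fderiv_comp_sub (𝕜 := ℝ) w.2
  simp only [h]
  exact ((contDiff_kernel hη ε).continuous_fderiv (by simp)).comp
    (continuous_fst.sub continuous_snd)

theorem exists_norm_fderiv_kernel_sub_le (hη : ContDiff ℝ ∞ η)
    (hηs : tsupport η ⊆ Metric.closedBall 0 1) (hε : 0 < ε) :
    ∃ C, ∀ x y : Space N, ‖fderiv ℝ (fun z => kernel η ε (z - y)) x‖ ≤ C := by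
  obtain ⟨C, hC⟩ := ((hasCompactSupport_kernel hηs hε).fderiv
    (𝕜 := ℝ)).exists_bound_of_continuous ((contDiff_kernel hη ε).continuous_fderiv (by simp))
  refine ⟨C, fun x y => ?_⟩
  have h : fderiv ℝ (fun z => kernel η ε (z - y)) x =
      fderiv ℝ (kernel η ε) (x - y) := fderiv_comp_sub (𝕜 := ℝ) y
  rw [h]
  exact hC _

variable [IsFiniteMeasure τ] [IsFiniteMeasure (volume.restrict Ω)]

theorem HasIntegralBounds.integrable_commutator_integrand
    (hb : HasIntegralBounds τ (volume.restrict Ω) u ρ) (hη : ContDiff ℝ ∞ η)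
    (hηs : tsupport η ⊆ Metric.closedBall 0 1) (hε : 0 < ε) :
    Integrable (fun z : (X × Space N) × Space N => ρ z.1.1 z.2 *
      fderiv ℝ (fun w => kernel η ε (w - z.2)) z.1.2 (u z.1.1 z.2 - u z.1.1 z.1.2))
      ((τ.prod (volume.restrict Ω)).prod (volume.restrict Ω)) := by
  obtain ⟨C, hC⟩ := exists_norm_fderiv_kernel_sub_le hη hηs hε
  have hA : AEStronglyMeasurable (fun z : (X × Space N) × Space N =>
      fderiv ℝ (fun w => kernel η ε (w - z.2)) z.1.2)
      ((τ.prod (volume.restrict Ω)).prod (volume.restrict Ω)) :=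
    ((continuous_fderiv_kernel_sub hη ε).stronglyMeasurable.comp_measurable
      (measurable_fst.snd.prodMk measurable_snd)).aestronglyMeasurable
  refine (integrable_bdd_clm_apply hA (fun z => hC _ _)
    (hb.integrable_flux.sub hb.integrable_cross)).congr (Eventually.of_forall fun z => ?_)
  simp only [Pi.sub_apply, ← smul_sub, map_smul, smul_eq_mul]

theorem HasIntegralBounds.integrable_mollify_integrand
    (hb : HasIntegralBounds τ (volume.restrict Ω) u ρ) (hη : ContDiff ℝ ∞ η)
    (hηs : tsupport η ⊆ Metric.closedBall 0 1) (hε : 0 < ε) :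
    Integrable (fun z : (X × Space N) × Space N => ρ z.1.1 z.2 * kernel η ε (z.1.2 - z.2))
      ((τ.prod (volume.restrict Ω)).prod (volume.restrict Ω)) ∧
    Integrable (fun z : (X × Space N) × Space N =>
        (ρ z.1.1 z.2 * kernel η ε (z.1.2 - z.2)) • u z.1.1 z.1.2)
      ((τ.prod (volume.restrict Ω)).prod (volume.restrict Ω)) := by
  obtain ⟨C, hC⟩ := (hasCompactSupport_kernel hηs hε).exists_bound_of_continuous
    (contDiff_kernel hη ε).continuous
  have hA : AEStronglyMeasurable (fun z : (X × Space N) × Space N =>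
      kernel η ε (z.1.2 - z.2)) ((τ.prod (volume.restrict Ω)).prod (volume.restrict Ω)) :=
    ((contDiff_kernel hη ε).continuous.stronglyMeasurable.comp_measurable
      (measurable_fst.snd.sub measurable_snd)).aestronglyMeasurable
  refine ⟨hb.integrable_density.mul_bdd hA (Eventually.of_forall fun z => hC _),
    (hb.integrable_cross.bdd_smul C hA (Eventually.of_forall fun z => hC _)).congr
      (Eventually.of_forall fun z => ?_)⟩
  simp only [Pi.smul_apply', smul_smul, mul_comm]

end Kernel

end

/-! ### Convergence of the commutator in `L^1(0,T;L^γ)`, from local to global. -/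

section

variable {N : ℕ}

/-- Subadditivity of the power `1 / γ`, valid since `γ ≥ 1`. It is used to glue finitely many
neighbourhoods. -/
theorem eLpNorm_restrict_union_le {F : Type*} [NormedAddCommGroup F] {γ : ℝ≥0∞} (hγ : 1 ≤ γ)
    (hγ' : γ ≠ ⊤) (f : Space N → F) (s t : Set (Space N)) :
    eLpNorm f γ (volume.restrict (s ∪ t)) ≤
      eLpNorm f γ (volume.restrict s) + eLpNorm f γ (volume.restrict t) := by
  have h0 : γ ≠ 0 := (zero_lt_one.trans_le hγ).ne'
  have h1 : 1 ≤ γ.toReal := by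
    simpa using (ENNReal.toReal_le_toReal (by simp) hγ').2 hγ
  refine (eLpNorm_mono_measure f (Measure.restrict_union_le s t)).trans ?_
  simp only [eLpNorm_eq_lintegral_rpow_enorm_toReal h0 hγ', lintegral_add_measure]
  exact ENNReal.rpow_add_le_add_rpow _ _ (by positivity) ((div_le_one (by linarith)).2 h1)

theorem commutator_eq_spatialCommutator (Ω : Set (Space N)) (η : Space N → ℝ)
    (u : ℝ → Space N → Space N) (ρ : ℝ → Space N → ℝ) (ε t : ℝ) :
    commutator Ω η u ρ ε t = spatialCommutator Ω η (u t) (ρ t) ε := rfl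

section Hypotheses

variable {T : ℝ} {Ω : Opens (Space N)} {p q α : ℝ≥0∞} {u : ℝ → Space N → Space N}
  {ρ : ℝ → Space N → ℝ}

theorem isFiniteMeasure_restrict_of_isBounded {Ω : Set (Space N)}
    (hΩ : Bornology.IsBounded Ω) : IsFiniteMeasure (volume.restrict Ω) :=
  ⟨by simpa using hΩ.measure_lt_top⟩

theorem MemLinftyLp.exists_ae_eLpNorm_le {Ω : Set (Space N)} (hρ : MemLinftyLp T Ω p ρ) :
    ∃ M : ℝ≥0∞, M ≠ ⊤ ∧
      ∀ᵐ t ∂(volume.restrict (Ioo 0 T)), eLpNorm (ρ t) p (volume.restrict Ω) ≤ M :=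
  ⟨_, hρ.2.ne, ae_le_essSup⟩

theorem one_le_of_conjugate (hpq : p⁻¹ + q⁻¹ = 1) : 1 ≤ q := by
  rw [← ENNReal.inv_le_inv, inv_one, ← hpq]
  exact le_add_self

/-- Boundedness of `Ω` gives `L^α ⊆ L^q ⊆ L^1`, and Hölder with the conjugate pair `p`, `q` controls
the flux `ρ u`. From here on the Fubini arguments need only `L^1` bounds. -/
theorem hasIntegralBounds (hΩ : Bornology.IsBounded (Ω : Set (Space N)))
    (hp : 1 < p) (hpq : p⁻¹ + q⁻¹ = 1) (hα : q ≤ α) (hu : MemL1W1 T Ω α u)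
    (hρ : MemLinftyLp T Ω p ρ) :
    HasIntegralBounds (volume.restrict (Ioo 0 T)) (volume.restrict (Ω : Set (Space N))) u ρ := by
  have hfin := isFiniteMeasure_restrict_of_isBounded hΩ
  obtain ⟨hum, G, -, -, hint⟩ := hu
  obtain ⟨M, hM, hM'⟩ := hρ.exists_ae_eLpNorm_le
  have hq := one_le_of_conjugate hpq
  have : ENNReal.HolderTriple p q 1 := ⟨by simpa using hpq⟩
  obtain ⟨c, hc, hc'⟩ := exists_eLpNorm_le_const_mul (F := ℝ)
    (volume.restrict (Ω : Set (Space N))) one_ne_zero hp.le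
  obtain ⟨d, hd, hd'⟩ := exists_eLpNorm_le_const_mul (F := Space N)
    (volume.restrict (Ω : Set (Space N))) one_ne_zero hq
  obtain ⟨e, he, he'⟩ := exists_eLpNorm_le_const_mul (F := Space N)
    (volume.restrict (Ω : Set (Space N))) (zero_lt_one.trans_le hq).ne' hα
  have hUα : ∫⁻ t in Ioo 0 T, eLpNorm (u t) α (volume.restrict (Ω : Set (Space N))) < ⊤ :=
    (lintegral_mono fun t => le_self_add).trans_lt hint
  have hUq : ∫⁻ t in Ioo 0 T, eLpNorm (u t) q (volume.restrict (Ω : Set (Space N))) < ⊤ := by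
    refine (lintegral_mono_ae (g := fun t => e * eLpNorm (u t) α
      (volume.restrict (Ω : Set (Space N)))) ?_).trans_lt ?_
    · filter_upwards [hum.prodMk_left] with t ht using he' _ ht
    · rw [lintegral_const_mul' _ _ he]
      exact ENNReal.mul_lt_top he.lt_top hUα
  refine ⟨hρ.1, hum, ⟨c * M, ENNReal.mul_ne_top hc hM, ?_⟩, ?_, ?_⟩
  · filter_upwards [hM', hρ.1.prodMk_left] with t ht ht'
    exact (hc' _ ht').trans (mul_le_mul_right ht _)
  · refine (lintegral_mono_ae (g := fun t => d * eLpNorm (u t) q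
      (volume.restrict (Ω : Set (Space N)))) ?_).trans_lt ?_
    · filter_upwards [hum.prodMk_left] with t ht using hd' _ ht
    · rw [lintegral_const_mul' _ _ hd]
      exact ENNReal.mul_lt_top hd.lt_top hUq
  · refine (lintegral_mono_ae (g := fun t => M * eLpNorm (u t) q
      (volume.restrict (Ω : Set (Space N)))) ?_).trans_lt ?_
    · filter_upwards [hM', hρ.1.prodMk_left, hum.prodMk_left] with t ht ht' ht''
      exact (eLpNorm_smul_le_mul_eLpNorm (p := p) (q := q) ht'' ht').trans (mul_le_mul_left ht _)
    · rw [lintegral_const_mul' _ _ hM]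
      exact ENNReal.mul_lt_top hM.lt_top hUq

theorem exists_ae_isTimeSlice (hu : MemL1W1 T Ω α u) (hρ : MemLinftyLp T Ω p ρ)
    (hdiv : ∀ᵐ t ∂(volume.restrict (Ioo 0 T)), IsDivFree Ω (u t)) :
    ∃ G : ℝ → Space N → (Space N →L[ℝ] Space N),
      ∫⁻ t in Ioo 0 T, eLpNorm (G t) α (volume.restrict (Ω : Set (Space N))) < ⊤ ∧
      ∀ᵐ t ∂(volume.restrict (Ioo 0 T)), IsTimeSlice Ω p α (u t) (G t) (ρ t) := by
  obtain ⟨hum, G, hGm, hw, hint⟩ := hu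
  have hU : ∫⁻ t in Ioo 0 T, eLpNorm (u t) α (volume.restrict (Ω : Set (Space N))) < ⊤ :=
    (lintegral_mono fun t => le_self_add).trans_lt hint
  have hG : ∫⁻ t in Ioo 0 T, eLpNorm (G t) α (volume.restrict (Ω : Set (Space N))) < ⊤ :=
    (lintegral_mono fun t => le_add_self).trans_lt hint
  obtain ⟨M, hM, hM'⟩ := hρ.exists_ae_eLpNorm_le
  refine ⟨G, hG, ?_⟩
  filter_upwards [hw, hdiv, hM', hum.prodMk_left, hGm.prodMk_left, hρ.1.prodMk_left,
    ae_lt_top' (aemeasurable_eLpNorm_slice hum α) hU.ne,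
    ae_lt_top' (aemeasurable_eLpNorm_slice hGm α) hG.ne] with t h1 h2 h3 h4 h5 h6 h7 h8
  exact ⟨⟨h6, h3.trans_lt hM.lt_top⟩, ⟨h4, h7⟩, ⟨h5, h8⟩, h1, h2⟩

theorem integrable_commutator (hΩ : Bornology.IsBounded (Ω : Set (Space N)))
    (hb : HasIntegralBounds (volume.restrict (Ioo 0 T)) (volume.restrict (Ω : Set (Space N))) u ρ)
    {η : Space N → ℝ} (hη : ContDiff ℝ ∞ η) (hηs : tsupport η ⊆ Metric.closedBall 0 1)
    {ε : ℝ} (hε : 0 < ε) :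
    Integrable (Function.uncurry (commutator Ω η u ρ ε)) (cylMeasure T Ω) := by
  have hfin := isFiniteMeasure_restrict_of_isBounded hΩ
  exact (hb.integrable_commutator_integrand hη hηs hε).integral_prod_left

/-- Dominated convergence in time: the estimate at a fixed time is linear in `eLpNorm (G t) α`,
which is integrable in `t`, while the density enters through its uniform bound `M`. -/
theorem tendsto_lintegral_commutator_local (hΩ : Bornology.IsBounded (Ω : Set (Space N)))
    {η : Space N → ℝ} (hη : ContDiff ℝ ∞ η) (hηs : tsupport η ⊆ Metric.closedBall 0 1)
    {γ : ℝ≥0∞} [ht : ENNReal.HolderTriple p α γ]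
    (hp : 1 ≤ p) (hα : 1 ≤ α) (hγ : 1 ≤ γ) (hγ' : γ ≠ ⊤)
    (hm : ∀ ε, 0 < ε →
      AEStronglyMeasurable (Function.uncurry (commutator Ω η u ρ ε)) (cylMeasure T Ω))
    {G : ℝ → Space N → (Space N →L[ℝ] Space N)}
    (hG : ∫⁻ t in Ioo 0 T, eLpNorm (G t) α (volume.restrict (Ω : Set (Space N))) < ⊤)
    (hs : ∀ᵐ t ∂(volume.restrict (Ioo 0 T)), IsTimeSlice Ω p α (u t) (G t) (ρ t))
    (hρ : ∃ M : ℝ≥0∞, M ≠ ⊤ ∧ ∀ᵐ t ∂(volume.restrict (Ioo 0 T)),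
      eLpNorm (ρ t) p (volume.restrict (Ω : Set (Space N))) ≤ M)
    {A : Set (Space N)} (hAm : MeasurableSet A) (hAΩ : A ⊆ Ω) {ν : Space N}
    (hA : ∀ᶠ ε in 𝓝[>] (0 : ℝ), HasInwardShift Ω A ν ε) :
    Tendsto (fun ε : ℝ => ∫⁻ t in Ioo 0 T,
      eLpNorm (commutator Ω η u ρ ε t) γ (volume.restrict A)) (𝓝[>] 0) (𝓝 0) := by
  have hηc : HasCompactSupport η :=
    (isCompact_closedBall (0 : Space N) 1).of_isClosed_subset (isClosed_tsupport η) hηs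
  obtain ⟨L, hL⟩ := (hηc.fderiv (𝕜 := ℝ)).exists_bound_of_continuous
    (hη.continuous_fderiv (by simp))
  obtain ⟨M, hM, hM'⟩ := hρ
  set C := ENNReal.ofReal L * ENNReal.ofReal (‖ν‖ + 1) * (segMeasure N univ * (3 * (2 * M)))
    with hC
  have hCtop : C ≠ ⊤ := ENNReal.mul_ne_top (ENNReal.mul_ne_top (by simp) (by simp))
    (ENNReal.mul_ne_top (measure_ne_top _ _) (ENNReal.mul_ne_top (by simp)
      (ENNReal.mul_ne_top (by simp) hM)))
  have h0 : ∫⁻ _ in Ioo 0 T, (0 : ℝ≥0∞) = 0 := by simp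
  rw [← h0]
  refine tendsto_lintegral_filter_of_dominated_convergence'
    (fun t => C * eLpNorm (G t) α (volume.restrict (Ω : Set (Space N)))) ?_ ?_ ?_ ?_
  · filter_upwards [self_mem_nhdsWithin] with ε hε
    refine aemeasurable_eLpNorm_slice ((hm ε hε).mono_measure ?_) γ
    exact Measure.prod_mono le_rfl (Measure.restrict_mono hAΩ le_rfl)
  · filter_upwards [self_mem_nhdsWithin, hA] with ε hε hAε
    filter_upwards [hs, hM'] with t hst ht
    refine ((hst.commutator_estimate hΩ hη hηs hL hp hα hγ hγ' hAm hAΩ hA).1 ε hε hAε).trans ?_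
    calc _ ≤ ENNReal.ofReal L * ENNReal.ofReal (‖ν‖ + 1) * (segMeasure N univ * (3 * (2 *
          (M * eLpNorm (G t) α (volume.restrict (Ω : Set (Space N))))))) := by gcongr
      _ = _ := by rw [hC]; ring
  · rw [lintegral_const_mul' _ _ hCtop]
    exact (ENNReal.mul_lt_top hCtop.lt_top hG).ne
  · filter_upwards [hs] with t hst
    simp only [commutator_eq_spatialCommutator]
    exact (hst.commutator_estimate hΩ hη hηs hL hp hα hγ hγ' hAm hAΩ hA).2

/-- The local convergence of the commutator error, at all points of a compact set, is uniform
on the compact set. -/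
theorem tendsto_lintegral_commutator_of_local {η : Space N → ℝ} {γ : ℝ≥0∞} (hγ : 1 ≤ γ)
    (hγ' : γ ≠ ⊤)
    (hm : ∀ ε, 0 < ε →
      AEStronglyMeasurable (Function.uncurry (commutator Ω η u ρ ε)) (cylMeasure T Ω))
    {K : Set (Space N)} (hK : IsCompact K)
    (hloc : ∀ x ∈ K, ∃ r > 0, Tendsto (fun ε : ℝ => ∫⁻ t in Ioo 0 T,
      eLpNorm (commutator Ω η u ρ ε t) γ (volume.restrict (Ω ∩ Metric.ball x r)))
        (𝓝[>] 0) (𝓝 0)) :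
    Tendsto (fun ε : ℝ => ∫⁻ t in Ioo 0 T,
      eLpNorm (commutator Ω η u ρ ε t) γ (volume.restrict (Ω ∩ K))) (𝓝[>] 0) (𝓝 0) := by
  let P : Set (Space N) → Prop := fun S => Tendsto (fun ε : ℝ => ∫⁻ t in Ioo 0 T,
    eLpNorm (commutator Ω η u ρ ε t) γ (volume.restrict ((Ω : Set (Space N)) ∩ S)))
      (𝓝[>] 0) (𝓝 0)
  suffices hP : P K from hP
  -- The property passes to subsets and finite unions and holds near each point of `K`, so
  -- compactness gives it for `K`.
  refine hK.induction_on (p := P) ?_ ?_ ?_ ?_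
  · simp [P]
  · intro S S' hSS' h
    refine tendsto_of_tendsto_of_tendsto_of_le_of_le tendsto_const_nhds h
      (fun _ => zero_le) fun ε => lintegral_mono fun t => eLpNorm_mono_measure _
        (Measure.restrict_mono (inter_subset_inter_right _ hSS') le_rfl)
  · intro S S' h h'
    have h2 := Tendsto.add (M := ℝ≥0∞) h h'
    rw [add_zero] at h2
    refine tendsto_of_tendsto_of_tendsto_of_le_of_le' tendsto_const_nhds h2
      (Eventually.of_forall fun _ => zero_le) ?_
    filter_upwards [self_mem_nhdsWithin] with ε hε
    rw [← lintegral_add_left']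
    · refine lintegral_mono fun t => ?_
      rw [inter_union_distrib_left]
      exact eLpNorm_restrict_union_le hγ hγ' _ _ _
    · refine aemeasurable_eLpNorm_slice ((hm ε hε).mono_measure ?_) γ
      exact Measure.prod_mono le_rfl (Measure.restrict_mono inter_subset_left le_rfl)
  · intro x hx
    obtain ⟨r, hr, h⟩ := hloc x hx
    exact ⟨Metric.ball x r, mem_nhdsWithin_of_mem_nhds (Metric.ball_mem_nhds x hr), h⟩

/-- For compact `Ω₀` interior points suffice. With a smooth boundary the compact set to be covered
is the closure of `Ω`, whose additional points are boundary points; smaller sets follow by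
monotonicity, without measurability. -/
theorem tendsto_lintegral_commutator_of_holderTriple
    (hΩ : Bornology.IsBounded (Ω : Set (Space N)))
    {η : Space N → ℝ} (hη : ContDiff ℝ ∞ η) (hηs : tsupport η ⊆ Metric.closedBall 0 1)
    {γ : ℝ≥0∞} [ht : ENNReal.HolderTriple p α γ]
    (hp : 1 ≤ p) (hα : 1 ≤ α) (hγ : 1 ≤ γ) (hγ' : γ ≠ ⊤)
    (hm : ∀ ε, 0 < ε →
      AEStronglyMeasurable (Function.uncurry (commutator Ω η u ρ ε)) (cylMeasure T Ω))
    {G : ℝ → Space N → (Space N →L[ℝ] Space N)}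
    (hG : ∫⁻ t in Ioo 0 T, eLpNorm (G t) α (volume.restrict (Ω : Set (Space N))) < ⊤)
    (hs : ∀ᵐ t ∂(volume.restrict (Ioo 0 T)), IsTimeSlice Ω p α (u t) (G t) (ρ t))
    (hρ : ∃ M : ℝ≥0∞, M ≠ ⊤ ∧ ∀ᵐ t ∂(volume.restrict (Ioo 0 T)),
      eLpNorm (ρ t) p (volume.restrict (Ω : Set (Space N))) ≤ M)
    {Ω₀ : Set (Space N)} (hΩ₀ : Ω₀ ⊆ Ω)
    (h : IsCompact Ω₀ ∨ HasSmoothBoundary (Ω : Set (Space N))) :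
    Tendsto (fun ε : ℝ => ∫⁻ t in Ioo 0 T,
      eLpNorm (commutator Ω η u ρ ε t) γ (volume.restrict Ω₀)) (𝓝[>] 0) (𝓝 0) := by
  have hloc : ∀ x, (∃ (ν : Space N) (r : ℝ), 0 < r ∧ ∀ᶠ ε in 𝓝[>] (0 : ℝ),
      HasInwardShift (Ω : Set (Space N)) (Ω ∩ Metric.ball x r) ν ε) →
      ∃ r > 0, Tendsto (fun ε : ℝ => ∫⁻ t in Ioo 0 T,
        eLpNorm (commutator Ω η u ρ ε t) γ (volume.restrict (Ω ∩ Metric.ball x r)))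
          (𝓝[>] 0) (𝓝 0) := by
    rintro x ⟨ν, r, hr, hA⟩
    exact ⟨r, hr, tendsto_lintegral_commutator_local hΩ hη hηs hp hα hγ hγ' hm hG hs hρ
      (Ω.isOpen.measurableSet.inter measurableSet_ball) inter_subset_left hA⟩
  rcases h with hc | hbd
  · have := tendsto_lintegral_commutator_of_local hγ hγ' hm hc fun x hx =>
      hloc x (exists_hasInwardShift_of_mem Ω.isOpen (hΩ₀ hx))
    rwa [inter_eq_right.2 hΩ₀] at this
  · have := tendsto_lintegral_commutator_of_local hγ hγ' hm hΩ.isCompact_closure fun x hx => by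
      by_cases hxΩ : x ∈ (Ω : Set (Space N))
      · exact hloc x (exists_hasInwardShift_of_mem Ω.isOpen hxΩ)
      · refine hloc x (exists_hasInwardShift_of_mem_frontier hbd ?_)
        rw [Ω.isOpen.frontier_eq]
        exact ⟨hx, hxΩ⟩
    rw [inter_eq_left.2 subset_closure] at this
    exact tendsto_of_tendsto_of_tendsto_of_le_of_le tendsto_const_nhds this
      (fun _ => zero_le) fun ε => lintegral_mono fun t => eLpNorm_mono_measure _
        (Measure.restrict_mono hΩ₀ le_rfl)

/-- The commutator error tends to zero in `L^1(0,T;L^γ(Ω₀))`. -/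
theorem tendsto_lintegral_commutator (hΩ : Bornology.IsBounded (Ω : Set (Space N)))
    (hp : 1 < p) (hα : 1 ≤ α) (hu : MemL1W1 T Ω α u)
    (hdiv : ∀ᵐ t ∂(volume.restrict (Ioo 0 T)), IsDivFree Ω (u t))
    (hρ : MemLinftyLp T Ω p ρ)
    {η : Space N → ℝ} (hη : ContDiff ℝ ∞ η) (hηs : tsupport η ⊆ Metric.closedBall 0 1)
    (hm : ∀ ε, 0 < ε →
      AEStronglyMeasurable (Function.uncurry (commutator Ω η u ρ ε)) (cylMeasure T Ω))
    {γ : ℝ≥0∞} (hγ : 1 ≤ γ) (hγ' : γ ≠ ⊤) (hγα : γ⁻¹ = α⁻¹ + p⁻¹ ∨ (α = ⊤ ∧ p = ⊤))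
    {Ω₀ : Set (Space N)} (hΩ₀ : Ω₀ ⊆ Ω)
    (h : IsCompact Ω₀ ∨ HasSmoothBoundary (Ω : Set (Space N))) :
    Tendsto (fun ε : ℝ => ∫⁻ t in Ioo 0 T,
      eLpNorm (commutator Ω η u ρ ε t) γ (volume.restrict Ω₀)) (𝓝[>] 0) (𝓝 0) := by
  have hfin := isFiniteMeasure_restrict_of_isBounded hΩ
  obtain ⟨G, hG, hs⟩ := exists_ae_isTimeSlice hu hρ hdiv
  rcases hγα with hγα | ⟨rfl, rfl⟩
  · have ht : ENNReal.HolderTriple p α γ := ⟨by rw [hγα, add_comm]⟩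
    exact tendsto_lintegral_commutator_of_holderTriple hΩ hη hηs hp.le hα hγ hγ' hm hG hs
      hρ.exists_ae_eLpNorm_le hΩ₀ h
  -- For `α = p = ∞` the Hölder relation would force `γ = ∞`. Since `Ω` is bounded, the velocity may
  -- be regarded as a `W^{1,γ}` field instead, with exponents `∞`, `γ`, `γ`.
  · have ht : ENNReal.HolderTriple ⊤ γ γ := ⟨by simp⟩
    obtain ⟨c, hc, hc'⟩ := exists_eLpNorm_le_const_mul (F := Space N →L[ℝ] Space N)
      (volume.restrict (Ω : Set (Space N))) (zero_lt_one.trans_le hγ).ne' (le_top (a := γ))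
    have hG' : ∫⁻ t in Ioo 0 T, eLpNorm (G t) γ (volume.restrict (Ω : Set (Space N))) < ⊤ := by
      refine (lintegral_mono_ae (g := fun t => c * eLpNorm (G t) ⊤
        (volume.restrict (Ω : Set (Space N)))) ?_).trans_lt ?_
      · filter_upwards [hs] with t ht using hc' _ ht.gradient.1
      · rw [lintegral_const_mul' _ _ hc]
        exact ENNReal.mul_lt_top hc.lt_top hG
    have hs' : ∀ᵐ t ∂(volume.restrict (Ioo 0 T)), IsTimeSlice Ω ⊤ γ (u t) (G t) (ρ t) := by
      filter_upwards [hs] with t ht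
      exact ⟨ht.density, ht.velocity.mono_exponent le_top, ht.gradient.mono_exponent le_top,
        ht.weakDeriv, ht.divFree⟩
    exact tendsto_lintegral_commutator_of_holderTriple hΩ hη hηs hp.le hγ hγ hγ' hm hG' hs'
      hρ.exists_ae_eLpNorm_le hΩ₀ h

end Hypotheses

end

/-! ### The adjoint mollification and the commutator identity at a fixed time. -/

section

variable {N : ℕ}

theorem contDiff_integral_mul_comp_sub {g k : Space N → ℝ} (hg : Integrable g volume)
    (hk : ContDiff ℝ ∞ k) (hkc : HasCompactSupport k) :
    ContDiff ℝ ∞ (fun x => ∫ y, g y * k (x - y)) ∧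
      ∀ x w, fderiv ℝ (fun x => ∫ y, g y * k (x - y)) x w =
        ∫ y, g y * fderiv ℝ k (x - y) w := by
  refine ⟨hkc.contDiff_convolution_right (ContinuousLinearMap.mul ℝ ℝ) hg.locallyIntegrable hk,
    fun x w => ?_⟩
  have h := hkc.hasFDerivAt_convolution_right (ContinuousLinearMap.mul ℝ ℝ)
    hg.locallyIntegrable (hk.of_le (by simp)) x
  have h' : fderiv ℝ (fun x => ∫ y, g y * k (x - y)) x = _ := h.fderiv
  rw [h', convolution_precompR_apply _ hg.locallyIntegrable (hkc.fderiv (𝕜 := ℝ))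
    (hk.continuous_fderiv (by simp))]
  rfl

theorem mollify_eq_integral_indicator {Ω : Set (Space N)} (hΩ : MeasurableSet Ω)
    (η : Space N → ℝ) (ε : ℝ) (f : Space N → ℝ) :
    mollify Ω η ε f = fun x => ∫ y, Ω.indicator f y * kernel η ε (x - y) := by
  ext x
  rw [mollify, ← integral_indicator hΩ]
  congr 1
  ext y
  by_cases hy : y ∈ Ω <;> simp [hy]

/-- The adjoint of `mollify`. -/
def dualMollify (η : Space N → ℝ) (ε : ℝ) (χ : Space N → ℝ) (y : Space N) : ℝ :=
  ∫ x, χ x * kernel η ε (x - y)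

section FixedTime

variable {η : Space N → ℝ} {ε : ℝ} {Ω : Opens (Space N)} {f : Space N → ℝ}

theorem contDiff_mollify (hη : ContDiff ℝ ∞ η)
    (hηs : tsupport η ⊆ Metric.closedBall 0 1) (hε : 0 < ε)
    (hf : Integrable f (volume.restrict (Ω : Set (Space N)))) :
    ContDiff ℝ ∞ (mollify Ω η ε f) ∧ ∀ x w, fderiv ℝ (mollify Ω η ε f) x w =
      ∫ y in (Ω : Set (Space N)), f y * fderiv ℝ (kernel η ε) (x - y) w := by
  have h := contDiff_integral_mul_comp_sub
    ((integrable_indicator_iff Ω.isOpen.measurableSet).2 hf)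
    (contDiff_kernel hη ε) (hasCompactSupport_kernel hηs hε)
  rw [mollify_eq_integral_indicator Ω.isOpen.measurableSet]
  refine ⟨h.1, fun x w => ?_⟩
  rw [h.2, ← integral_indicator Ω.isOpen.measurableSet]
  congr 1
  ext y
  by_cases hy : y ∈ (Ω : Set (Space N)) <;> simp [hy]

/-- The sign comes from differentiating the kernel at `x - y` with respect to `y`. It makes the flux
part of the commutator the negative of the tested transport term. -/
theorem fderiv_dualMollify (hη : ContDiff ℝ ∞ η)
    (hηs : tsupport η ⊆ Metric.closedBall 0 1) (hε : 0 < ε) {χ : Space N → ℝ}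
    (hχ : Integrable χ volume) (y w : Space N) :
    fderiv ℝ (dualMollify η ε χ) y w = - ∫ x, χ x * fderiv ℝ (kernel η ε) (x - y) w := by
  have hk : ContDiff ℝ ∞ fun z => kernel η ε (-z) := (contDiff_kernel hη ε).comp contDiff_neg
  have hkc : HasCompactSupport fun z => kernel η ε (-z) :=
    (hasCompactSupport_kernel hηs hε).comp_homeomorph (Homeomorph.neg (Space N))
  have h := (contDiff_integral_mul_comp_sub hχ hk hkc).2 y w
  simp only [neg_sub] at h
  change fderiv ℝ (fun y => ∫ x, χ x * kernel η ε (x - y)) y w = _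
  rw [h, ← integral_neg]
  congr 1
  ext x
  have h1 : fderiv ℝ (fun z => kernel η ε (-z)) (y - x) = - fderiv ℝ (kernel η ε) (-(y - x)) :=
    (((contDiff_kernel hη ε).differentiable (by simp) _).hasFDerivAt.comp (y - x)
      (hasFDerivAt_id (𝕜 := ℝ) (y - x)).neg).fderiv.trans (by ext; simp)
  rw [h1, neg_sub, neg_apply, mul_neg]

variable {χ : Space N → ℝ}

theorem setIntegral_mul_eq_integral_of_eq_zero (hχ0 : ∀ x ∉ (Ω : Set (Space N)), χ x = 0)
    (g : Space N → ℝ) : ∫ x in (Ω : Set (Space N)), χ x * g x = ∫ x, χ x * g x :=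
  setIntegral_eq_integral_of_forall_compl_eq_zero fun x hx => by simp [hχ0 x hx]

theorem integral_mul_dualMollify (hη : ContDiff ℝ ∞ η)
    (hηs : tsupport η ⊆ Metric.closedBall 0 1) (hε : 0 < ε)
    (hf : Integrable f (volume.restrict (Ω : Set (Space N))))
    (hχ : Integrable χ volume) (hχ0 : ∀ x ∉ (Ω : Set (Space N)), χ x = 0) :
    ∫ y in (Ω : Set (Space N)), f y * dualMollify η ε χ y =
      ∫ x in (Ω : Set (Space N)), mollify Ω η ε f x * χ x := by
  obtain ⟨C, hC⟩ := (hasCompactSupport_kernel hηs hε).exists_bound_of_continuous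
    (contDiff_kernel hη ε).continuous
  have hint : Integrable (fun z : Space N × Space N => f z.1 * χ z.2 * kernel η ε (z.2 - z.1))
      ((volume.restrict (Ω : Set (Space N))).prod (volume.restrict (Ω : Set (Space N)))) :=
    (hf.mul_prod hχ.restrict).mul_bdd (c := C)
      ((contDiff_kernel hη ε).continuous.comp (by fun_prop :
        Continuous fun z : Space N × Space N => z.2 - z.1)).aestronglyMeasurable
      (Eventually.of_forall fun z => hC _)
  calc _ = ∫ y in (Ω : Set (Space N)), ∫ x in (Ω : Set (Space N)),
        f y * χ x * kernel η ε (x - y) := by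
        simp only [dualMollify, ← setIntegral_mul_eq_integral_of_eq_zero hχ0, mul_assoc,
          integral_const_mul]
    _ = ∫ x in (Ω : Set (Space N)), ∫ y in (Ω : Set (Space N)),
        f y * χ x * kernel η ε (x - y) := integral_integral_swap hint
    _ = _ := by
        simp only [mollify, ← integral_mul_const, mul_right_comm]

/-- The commutator identity at a fixed time. -/
theorem integral_mul_fderiv_dualMollify (hη : ContDiff ℝ ∞ η)
    (hηs : tsupport η ⊆ Metric.closedBall 0 1) (hε : 0 < ε) {v : Space N → Space N}
    (hf : Integrable f (volume.restrict (Ω : Set (Space N))))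
    (hv : Integrable v (volume.restrict (Ω : Set (Space N))))
    (hfv : Integrable (fun x => f x • v x) (volume.restrict (Ω : Set (Space N))))
    (hdiv : IsDivFree Ω v) (hχ : ContDiff ℝ ∞ χ) (hχc : HasCompactSupport χ)
    (hχs : tsupport χ ⊆ (Ω : Set (Space N))) :
    ∫ y in (Ω : Set (Space N)), f y * fderiv ℝ (dualMollify η ε χ) y (v y) =
      (∫ x in (Ω : Set (Space N)), mollify Ω η ε f x * fderiv ℝ χ x (v x)) -
        ∫ x in (Ω : Set (Space N)), spatialCommutator Ω η v f ε x * χ x := by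
  have hκ := contDiff_kernel hη ε
  have hκ' := hκ.continuous_fderiv (by simp)
  obtain ⟨C, hC⟩ := ((hasCompactSupport_kernel hηs hε).fderiv
    (𝕜 := ℝ)).exists_bound_of_continuous hκ'
  obtain ⟨hm, hmd⟩ := contDiff_mollify hη hηs hε hf
  set m := mollify Ω η ε f with hmdef
  have hχi : Integrable χ volume := hχ.continuous.integrable_of_hasCompactSupport hχc
  have hχ0 : ∀ x ∉ (Ω : Set (Space N)), χ x = 0 := fun x hx =>
    image_eq_zero_of_notMem_tsupport fun h => hx (hχs h)
  have hsub : ∀ x y, fderiv ℝ (fun z => kernel η ε (z - y)) x = fderiv ℝ (kernel η ε) (x - y) :=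
    fun x y => fderiv_comp_sub (𝕜 := ℝ) y
  -- the flux term
  have hflux : ∀ x, Integrable (fun y => f y * fderiv ℝ (kernel η ε) (x - y) (v y))
      (volume.restrict (Ω : Set (Space N))) := by
    intro x
    refine (integrable_bdd_clm_apply (A := fun y => fderiv ℝ (kernel η ε) (x - y)) (C := C)
      (hκ'.comp (by fun_prop : Continuous fun y : Space N => x - y)).aestronglyMeasurable
      (fun y => hC _) hfv).congr (Eventually.of_forall fun y => ?_)
    simp
  have hgrad : ∀ x w, Integrable (fun y => f y * fderiv ℝ (kernel η ε) (x - y) w)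
      (volume.restrict (Ω : Set (Space N))) := by
    intro x w
    refine (integrable_bdd_clm_apply (A := fun y => fderiv ℝ (kernel η ε) (x - y)) (C := C)
      (hκ'.comp (by fun_prop : Continuous fun y : Space N => x - y)).aestronglyMeasurable
      (fun y => hC _) (hf.smul_const w)).congr (Eventually.of_forall fun y => ?_)
    simp
  -- In the part of the commutator containing `v x`, this vector does not depend on `y`, and the
  -- remaining integral is the gradient of the mollified density.
  have hr : ∀ x, spatialCommutator Ω η v f ε x =
      (∫ y in (Ω : Set (Space N)), f y * fderiv ℝ (kernel η ε) (x - y) (v y)) -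
        fderiv ℝ m x (v x) := by
    intro x
    rw [spatialCommutator, hmd, ← integral_sub (hflux x) (hgrad x (v x))]
    simp only [hsub, map_sub, mul_sub]
  have hint : Integrable (fun z : Space N × Space N =>
      χ z.1 * (f z.2 * fderiv ℝ (kernel η ε) (z.1 - z.2) (v z.2)))
      ((volume.restrict (Ω : Set (Space N))).prod (volume.restrict (Ω : Set (Space N)))) := by
    refine (integrable_bdd_clm_apply
      (A := fun z : Space N × Space N => fderiv ℝ (kernel η ε) (z.1 - z.2)) (C := C)
      (hκ'.comp (by fun_prop : Continuous fun z : Space N × Space N => z.1 - z.2)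
        ).aestronglyMeasurable (fun y => hC _)
      (hχi.restrict.smul_prod hfv)).congr (Eventually.of_forall fun z => ?_)
    simp
  have hswap : ∫ x in (Ω : Set (Space N)), χ x *
      ∫ y in (Ω : Set (Space N)), f y * fderiv ℝ (kernel η ε) (x - y) (v y) =
      - ∫ y in (Ω : Set (Space N)), f y * fderiv ℝ (dualMollify η ε χ) y (v y) := by
    calc _ = ∫ x in (Ω : Set (Space N)), ∫ y in (Ω : Set (Space N)),
          χ x * (f y * fderiv ℝ (kernel η ε) (x - y) (v y)) := by
          simp only [integral_const_mul]
      _ = ∫ y in (Ω : Set (Space N)), ∫ x in (Ω : Set (Space N)),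
          χ x * (f y * fderiv ℝ (kernel η ε) (x - y) (v y)) := integral_integral_swap hint
      _ = _ := by
          simp only [fderiv_dualMollify hη hηs hε hχi, mul_neg, integral_neg, neg_neg,
            ← setIntegral_mul_eq_integral_of_eq_zero hχ0, ← integral_const_mul]
          simp only [mul_left_comm]
  -- the divergence-free condition for the product
  let ψ : 𝓓(Ω, ℝ) := ⟨fun x => χ x * m x, hχ.mul hm, hχc.mul_right,
    (tsupport_mul_subset_left (f := χ) (g := m)).trans hχs⟩
  have hψ : ∀ x w, fderiv ℝ ψ x w = χ x * fderiv ℝ m x w + m x * fderiv ℝ χ x w := by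
    intro x w
    have h := fderiv_fun_mul (𝕜 := ℝ) (hχ.differentiable (by simp) x)
      (hm.differentiable (by simp) x)
    change fderiv ℝ (fun x => χ x * m x) x w = _
    rw [h]
    simp
  have i1 : Integrable (fun x => χ x * fderiv ℝ m x (v x))
      (volume.restrict (Ω : Set (Space N))) := by
    have hc : Continuous fun x => χ x • fderiv ℝ m x :=
      hχ.continuous.smul (hm.continuous_fderiv (by simp))
    obtain ⟨D, hD⟩ := (hχc.smul_right (f' := fun x => fderiv ℝ m x)).exists_bound_of_continuous hc
    exact integrable_bdd_clm_apply hc.aestronglyMeasurable hD hv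
  have i2 : Integrable (fun x => m x * fderiv ℝ χ x (v x))
      (volume.restrict (Ω : Set (Space N))) := by
    have hc : Continuous fun x => m x • fderiv ℝ χ x :=
      hm.continuous.smul (hχ.continuous_fderiv (by simp))
    obtain ⟨D, hD⟩ := ((hχc.fderiv (𝕜 := ℝ)).smul_left (f := m)).exists_bound_of_continuous hc
    exact integrable_bdd_clm_apply hc.aestronglyMeasurable hD hv
  have hdiv' := hdiv ψ
  simp only [hψ] at hdiv'
  rw [integral_add i1 i2] at hdiv'
  have e : ∫ x in (Ω : Set (Space N)), spatialCommutator Ω η v f ε x * χ x =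
      (∫ x in (Ω : Set (Space N)), χ x *
        ∫ y in (Ω : Set (Space N)), f y * fderiv ℝ (kernel η ε) (x - y) (v y)) -
      ∫ x in (Ω : Set (Space N)), χ x * fderiv ℝ m x (v x) := by
    rw [← integral_sub _ i1]
    · simp only [hr, ← mul_sub, mul_comm]
    · simpa only [integral_const_mul] using hint.integral_prod_left
  rw [e, hswap]
  linarith

end FixedTime

end

/-! ### Inner sets, cutoffs, and mollified test functions in space-time. -/

section

variable {N : ℕ}

/-- The ball is connected and meets `Ω`, so it could leave `Ω` only by meeting the frontier, which
is farther than `ε` from its centre. -/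
theorem closedBall_subset_of_mem_innerSet {Ω : Set (Space N)} (hΩ : IsOpen Ω) {ε : ℝ}
    {x : Space N} (hε : 0 ≤ ε) (hx : x ∈ innerSet Ω ε) : Metric.closedBall x ε ⊆ Ω := by
  refine (convex_closedBall x ε).isPreconnected.subset_left_of_subset_union hΩ
    (isClosed_closure (s := Ω)).isOpen_compl
    (disjoint_left.2 fun y hy hy' => hy' (subset_closure hy)) (fun z hz => ?_)
    ⟨x, Metric.mem_closedBall_self hε, hx.1⟩
  by_contra h
  simp only [mem_union, mem_compl_iff, not_or, not_not] at h
  have hzf : z ∈ frontier Ω := by rw [hΩ.frontier_eq]; exact ⟨h.2, h.1⟩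
  refine hx.2.not_ge ((Metric.infEDist_le_edist_of_mem hzf).trans ?_)
  rw [edist_dist, dist_comm]
  exact ENNReal.ofReal_le_ofReal hz

theorem isOpen_innerSet {Ω : Set (Space N)} (hΩ : IsOpen Ω) (ε : ℝ) : IsOpen (innerSet Ω ε) :=
  hΩ.inter (isOpen_lt continuous_const Metric.continuous_infEDist)

theorem subset_innerSet {Ω Ω₀ : Set (Space N)} {ε : ℝ} (hΩ₀ : Ω₀ ⊆ Ω)
    (h : ENNReal.ofReal ε < setDist Ω₀ (frontier Ω)) : Ω₀ ⊆ innerSet Ω ε :=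
  fun x hx => ⟨hΩ₀ hx, h.trans_le (iInf₂_le x hx)⟩

theorem innerSet_subset (Ω : Set (Space N)) (ε : ℝ) : innerSet Ω ε ⊆ Ω := fun _ h => h.1

theorem exists_contDiff_eq_one_tsupport_subset {K U : Set (Space N)} (hK : IsCompact K)
    (hU : IsOpen U) (hKU : K ⊆ U) :
    ∃ χ : Space N → ℝ, ContDiff ℝ ∞ χ ∧ (∀ x ∈ K, χ x = 1) ∧ tsupport χ ⊆ U := by
  obtain ⟨L, hL, hKL, hLU⟩ := exists_compact_between hK hU hKU
  obtain ⟨χ, hχ, -, h0, h1⟩ := exists_contMDiff_zero_iff_one_iff_of_isClosed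
    (modelWithCornersSelf ℝ (Space N)) (n := ⊤)
    (isOpen_interior (s := L)).isClosed_compl hK.isClosed
    (disjoint_left.2 fun x hx hx' => hx (hKL hx'))
  refine ⟨χ, hχ.contDiff, fun x hx => (h1 x).1 hx, ?_⟩
  refine (closure_minimal (fun x hx => ?_) hL.isClosed).trans hLU
  by_contra hxL
  exact hx ((h0 x).1 fun h => hxL (interior_subset h))

section SpaceTime

variable {g : ℝ × Space N → ℝ}

theorem timeDeriv_eq_fderiv (hg : ContDiff ℝ ∞ g) (t : ℝ) (x : Space N) :
    timeDeriv g t x = fderiv ℝ g (t, x) (1, 0) := by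
  have h := (hg.differentiable (by simp) (t, x)).hasFDerivAt.comp_hasDerivAt t
    ((hasDerivAt_id t).prodMk (hasDerivAt_const t x))
  exact h.deriv

theorem spaceDeriv_eq_fderiv (hg : ContDiff ℝ ∞ g) (t : ℝ) (x w : Space N) :
    spaceDeriv g t x w =
      (fderiv ℝ g (t, x)).comp (ContinuousLinearMap.inr ℝ ℝ (Space N)) w := by
  have h := (hg.differentiable (by simp) (t, x)).hasFDerivAt.comp x
    ((hasFDerivAt_const t x).prodMk (hasFDerivAt_id (𝕜 := ℝ) x))
  have h' : fderiv ℝ (fun z => g (t, z)) x = _ := h.fderiv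
  rw [spaceDeriv, h']
  simp

theorem hasDerivAt_timeDeriv (hg : ContDiff ℝ ∞ g) (t : ℝ) (x : Space N) :
    HasDerivAt (fun s => g (s, x)) (timeDeriv g t x) t :=
  ((hg.comp (contDiff_id.prodMk contDiff_const)).differentiable (by simp) t).hasDerivAt

theorem continuous_timeDeriv (hg : ContDiff ℝ ∞ g) :
    Continuous fun z : ℝ × Space N => timeDeriv g z.1 z.2 := by
  simp only [timeDeriv_eq_fderiv hg]
  exact (hg.continuous_fderiv (by simp)).clm_apply continuous_const

theorem contDiff_slice (hg : ContDiff ℝ ∞ g) (t : ℝ) : ContDiff ℝ ∞ fun x => g (t, x) :=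
  hg.comp (contDiff_const.prodMk contDiff_id)

theorem tsupport_slice_subset (g : ℝ × Space N → ℝ) (t : ℝ) :
    tsupport (fun x => g (t, x)) ⊆ Prod.mk t ⁻¹' tsupport g :=
  closure_minimal (fun _ hx => subset_tsupport g hx)
    ((isClosed_tsupport g).preimage (by fun_prop))

theorem hasCompactSupport_slice (hgc : HasCompactSupport g) (t : ℝ) :
    HasCompactSupport fun x => g (t, x) :=
  hgc.isCompact.image continuous_snd |>.of_isClosed_subset (isClosed_tsupport _)
    fun x hx => ⟨(t, x), tsupport_slice_subset g t hx, rfl⟩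

theorem timeDeriv_eq_zero {t : ℝ} {x : Space N} (h : ∀ s, g (s, x) = 0) :
    timeDeriv g t x = 0 := by
  simp [timeDeriv, h]

theorem spaceDeriv_eq_zero {t : ℝ} {x : Space N} (h : (t, x) ∉ tsupport g) (w : Space N) :
    spaceDeriv g t x w = 0 := by
  rw [spaceDeriv, fderiv_of_notMem_tsupport (𝕜 := ℝ) fun h' => h (tsupport_slice_subset g t h')]
  rfl

theorem hasCompactSupport_timeDeriv (hg : ContDiff ℝ ∞ g) (hgc : HasCompactSupport g) :
    HasCompactSupport fun z : ℝ × Space N => timeDeriv g z.1 z.2 := by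
  simp only [timeDeriv_eq_fderiv hg]
  exact (hgc.fderiv (𝕜 := ℝ)).comp_left (g := fun L : ℝ × Space N →L[ℝ] ℝ => L (1, 0)) rfl

variable {η : Space N → ℝ} {ε : ℝ}

/-- For each time this is a convolution with the reflected kernel. Joint smoothness is that of
convolutions depending on a parameter, since the slices of `g` are supported in one common compact
set. -/
theorem contDiff_dualMollify_slice (hη : ContDiff ℝ ∞ η)
    (hg : ContDiff ℝ ∞ g) (hgc : HasCompactSupport g) :
    ContDiff ℝ ∞ fun z : ℝ × Space N => dualMollify η ε (fun x => g (z.1, x)) z.2 := by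
  have hk : ContDiff ℝ ∞ fun z => kernel η ε (-z) := (contDiff_kernel hη ε).comp contDiff_neg
  have h := contDiffOn_convolution_right_with_param (n := ⊤) (μ := (volume : Measure (Space N)))
    (ContinuousLinearMap.mul ℝ ℝ) (g := fun (t : ℝ) x => g (t, x)) (s := univ)
    (k := Prod.snd '' tsupport g) isOpen_univ (hgc.isCompact.image continuous_snd)
    (fun t x _ hx => image_eq_zero_of_notMem_tsupport fun h => hx ⟨_, h, rfl⟩)
    hk.continuous.locallyIntegrable hg.contDiffOn
  rw [univ_prod_univ, contDiffOn_univ] at h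
  convert h using 2 with z
  rw [convolution_eq_swap]
  simp [dualMollify, mul_comm]

/-- The adjoint mollification spreads supports by `ε` in space and not at all in time, so support in
the inner set becomes support in `Ω` and times stay below `T`. -/
theorem tsupport_dualMollify_slice_subset
    (hηs : tsupport η ⊆ Metric.closedBall 0 1) (hε : 0 < ε) (hgc : HasCompactSupport g) :
    IsCompact ((fun z : (ℝ × Space N) × Space N => (z.1.1, z.1.2 - z.2)) ''
        (tsupport g ×ˢ Metric.closedBall 0 ε)) ∧
    tsupport (fun z : ℝ × Space N => dualMollify η ε (fun x => g (z.1, x)) z.2) ⊆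
      (fun z : (ℝ × Space N) × Space N => (z.1.1, z.1.2 - z.2)) ''
        (tsupport g ×ˢ Metric.closedBall 0 ε) := by
  have hK : IsCompact ((fun z : (ℝ × Space N) × Space N => (z.1.1, z.1.2 - z.2)) ''
      (tsupport g ×ˢ Metric.closedBall 0 ε)) :=
    (hgc.isCompact.prod (isCompact_closedBall _ _)).image (by fun_prop)
  refine ⟨hK, closure_minimal (fun z hz => ?_) hK.isClosed⟩
  by_contra h
  refine hz ?_
  have h0 : ∀ x, g (z.1, x) * kernel η ε (x - z.2) = 0 := by
    intro x
    by_contra hx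
    refine h ⟨((z.1, x), x - z.2), ⟨subset_tsupport g (left_ne_zero_of_mul hx), ?_⟩, by simp⟩
    rw [mem_closedBall_zero_iff]
    exact not_lt.1 fun hlt => right_ne_zero_of_mul hx (kernel_eq_zero hηs hε hlt)
  simp [dualMollify, h0]

theorem timeDeriv_dualMollify_slice (hη : ContDiff ℝ ∞ η)
    (hηs : tsupport η ⊆ Metric.closedBall 0 1) (hε : 0 < ε)
    (hg : ContDiff ℝ ∞ g) (hgc : HasCompactSupport g) (t : ℝ) (y : Space N) :
    timeDeriv (fun z => dualMollify η ε (fun x => g (z.1, x)) z.2) t y =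
      dualMollify η ε (timeDeriv g t) y := by
  obtain ⟨C, hC⟩ := (hasCompactSupport_timeDeriv hg hgc).exists_bound_of_continuous
    (continuous_timeDeriv hg)
  have hκ : Continuous fun x => kernel η ε (x - y) :=
    (contDiff_kernel hη ε).continuous.comp (by fun_prop)
  have hκc : HasCompactSupport fun x => kernel η ε (x - y) :=
    (hasCompactSupport_kernel hηs hε).comp_homeomorph (Homeomorph.subRight y)
  have hκi : Integrable (fun x => kernel η ε (x - y)) volume :=
    hκ.integrable_of_hasCompactSupport hκc
  have hcont : ∀ s, Continuous fun x => g (s, x) * kernel η ε (x - y) := fun s =>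
    (contDiff_slice hg s).continuous.mul hκ
  exact (hasDerivAt_integral_of_dominated_loc_of_deriv_le (s := univ) (x₀ := t)
    (F := fun s x => g (s, x) * kernel η ε (x - y))
    (F' := fun s x => timeDeriv g s x * kernel η ε (x - y))
    (bound := fun x => C * ‖kernel η ε (x - y)‖) univ_mem
    (Eventually.of_forall fun s => (hcont s).aestronglyMeasurable)
    ((hcont t).integrable_of_hasCompactSupport hκc.mul_left)
    (((continuous_timeDeriv hg).comp (by fun_prop : Continuous fun x : Space N => (t, x))).mul
      hκ).aestronglyMeasurable
    (Eventually.of_forall fun x s _ => by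
      rw [norm_mul]
      exact mul_le_mul_of_nonneg_right (hC (s, x)) (norm_nonneg _))
    (hκi.norm.const_mul C)
    (Eventually.of_forall fun x s _ =>
      (hasDerivAt_timeDeriv hg s x).mul_const _)).2.deriv

end SpaceTime

end

/-! ### The weak equation for the mollified density, with test functions supported in the inner set.
-/

section

variable {N : ℕ}

theorem HasIntegralBounds.ae_integrable {X : Type*} [MeasurableSpace X] {τ : Measure X}
    [SFinite τ] {μ : Measure (Space N)} [SFinite μ] {u : X → Space N → Space N}
    {ρ : X → Space N → ℝ} (hb : HasIntegralBounds τ μ u ρ) :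
    ∀ᵐ t ∂τ, Integrable (ρ t) μ ∧ Integrable (u t) μ ∧ Integrable (fun x => ρ t x • u t x) μ := by
  obtain ⟨M, hM, hM'⟩ := hb.density
  filter_upwards [hM', hb.aesm_density.prodMk_left, hb.aesm_velocity.prodMk_left,
    ae_lt_top' (aemeasurable_eLpNorm_slice hb.aesm_velocity 1) hb.velocity.ne,
    ae_lt_top' (aemeasurable_eLpNorm_slice (f := fun t x => ρ t x • u t x)
      (hb.aesm_density.smul hb.aesm_velocity) 1) hb.flux.ne] with t h1 h2 h3 h4 h5
  exact ⟨memLp_one_iff_integrable.1 ⟨h2, h1.trans_lt hM.lt_top⟩,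
    memLp_one_iff_integrable.1 ⟨h3, h4⟩, memLp_one_iff_integrable.1 ⟨h2.smul h3, h5⟩⟩

section WeakForm

variable {T : ℝ} {u : ℝ → Space N → Space N} {ρ : ℝ → Space N → ℝ} {ρ₀ : Space N → ℝ}
  {φ g : ℝ × Space N → ℝ}

/-- The derivative at `t` sees neighbouring times, hence the open interval in the conclusion. -/
theorem timeDeriv_congr (h : ∀ t ∈ Ico 0 T, ∀ x, φ (t, x) = g (t, x)) {t : ℝ}
    (ht : t ∈ Ioo 0 T) : timeDeriv φ t = timeDeriv g t :=
  funext fun x => EventuallyEq.deriv_eq (by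
    filter_upwards [Ioo_mem_nhds ht.1 ht.2] with s hs using h s ⟨hs.1.le, hs.2⟩ x)

theorem spaceDeriv_congr (h : ∀ t ∈ Ico 0 T, ∀ x, φ (t, x) = g (t, x)) {t : ℝ}
    (ht : t ∈ Ioo 0 T) : spaceDeriv φ t = spaceDeriv g t := by
  ext x w
  simp only [spaceDeriv, h t (Ioo_subset_Ico_self ht)]

theorem weakForm_congr (hT : 0 < T) (h : ∀ t ∈ Ico 0 T, ∀ x, φ (t, x) = g (t, x))
    (A : Set (Space N)) : weakForm T A u ρ ρ₀ φ = weakForm T A u ρ ρ₀ g := by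
  have h1 : ∫ t in Ioo 0 T, ∫ x in A, ρ t x * timeDeriv φ t x =
      ∫ t in Ioo 0 T, ∫ x in A, ρ t x * timeDeriv g t x :=
    setIntegral_congr_fun measurableSet_Ioo fun t ht => by simp only [timeDeriv_congr h ht]
  have h2 : ∫ t in Ioo 0 T, ∫ x in A, ρ t x * spaceDeriv φ t x (u t x) =
      ∫ t in Ioo 0 T, ∫ x in A, ρ t x * spaceDeriv g t x (u t x) :=
    setIntegral_congr_fun measurableSet_Ioo fun t ht => by simp only [spaceDeriv_congr h ht]
  rw [weakForm, weakForm, h1, h2]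
  simp only [h 0 ⟨le_rfl, hT⟩]

theorem weakForm_mono_set {A B : Set (Space N)} (hB : MeasurableSet B)
    (hAB : A ⊆ B) (hg : tsupport g ⊆ univ ×ˢ A) :
    weakForm T A u ρ ρ₀ g = weakForm T B u ρ ρ₀ g := by
  have h0 : ∀ t, ∀ x ∉ A, (t, x) ∉ tsupport g := fun t x hx h => hx (hg h).2
  have h1 : ∀ t, ∀ x ∉ A, g (t, x) = 0 := fun t x hx =>
    image_eq_zero_of_notMem_tsupport (h0 t x hx)
  have key : ∀ f : Space N → ℝ, (∀ x ∉ A, f x = 0) → ∫ x in A, f x = ∫ x in B, f x :=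
    fun f hf => (setIntegral_eq_of_subset_of_forall_sdiff_eq_zero hB hAB
      fun x hx => hf x hx.2).symm
  have e1 : ∀ t, ∫ x in A, ρ t x * timeDeriv g t x = ∫ x in B, ρ t x * timeDeriv g t x :=
    fun t => key _ fun x hx => by rw [timeDeriv_eq_zero fun s => h1 s x hx, mul_zero]
  have e2 : ∀ t, ∫ x in A, ρ t x * spaceDeriv g t x (u t x) =
      ∫ x in B, ρ t x * spaceDeriv g t x (u t x) :=
    fun t => key _ fun x hx => by rw [spaceDeriv_eq_zero (h0 t x hx), mul_zero]
  have e3 : ∫ x in A, ρ₀ x * g (0, x) = ∫ x in B, ρ₀ x * g (0, x) :=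
    key _ fun x hx => by rw [h1 0 x hx, mul_zero]
  simp only [weakForm, e1, e2, e3]

theorem ae_cylMeasure_mem_Ioo (T : ℝ) (A : Set (Space N)) :
    ∀ᵐ z ∂(cylMeasure T A), z.1 ∈ Ioo 0 T :=
  Measure.quasiMeasurePreserving_fst.ae (ae_restrict_mem measurableSet_Ioo)

theorem cylMeasure_mono {A B : Set (Space N)} (hAB : A ⊆ B) : cylMeasure T A ≤ cylMeasure T B :=
  Measure.prod_mono le_rfl (Measure.restrict_mono hAB le_rfl)

end WeakForm

section Mollified

variable {T : ℝ} {Ω : Opens (Space N)} {u : ℝ → Space N → Space N} {ρ : ℝ → Space N → ℝ}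
  {ρ₀ : Space N → ℝ} {η : Space N → ℝ} {ε : ℝ} {g : ℝ × Space N → ℝ}

theorem integrable_mollify_mul_timeDeriv
    (hΩ : Bornology.IsBounded (Ω : Set (Space N)))
    (hb : HasIntegralBounds (volume.restrict (Ioo 0 T)) (volume.restrict (Ω : Set (Space N))) u ρ)
    (hη : ContDiff ℝ ∞ η) (hηs : tsupport η ⊆ Metric.closedBall 0 1) (hε : 0 < ε)
    (hg : ContDiff ℝ ∞ g) (hgc : HasCompactSupport g) :
    Integrable (fun z : ℝ × Space N => mollify Ω η ε (ρ z.1) z.2 * timeDeriv g z.1 z.2)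
      (cylMeasure T Ω) := by
  have hfin := isFiniteMeasure_restrict_of_isBounded hΩ
  obtain ⟨C, hC⟩ := (hasCompactSupport_timeDeriv hg hgc).exists_bound_of_continuous
    (continuous_timeDeriv hg)
  have h : Integrable (fun z : ℝ × Space N => mollify Ω η ε (ρ z.1) z.2) (cylMeasure T Ω) :=
    (hb.integrable_mollify_integrand hη hηs hε).1.integral_prod_left
  exact h.mul_bdd (c := C) (continuous_timeDeriv hg).aestronglyMeasurable
    (Eventually.of_forall hC)

theorem integrable_mollify_mul_spaceDeriv
    (hΩ : Bornology.IsBounded (Ω : Set (Space N)))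
    (hb : HasIntegralBounds (volume.restrict (Ioo 0 T)) (volume.restrict (Ω : Set (Space N))) u ρ)
    (hη : ContDiff ℝ ∞ η) (hηs : tsupport η ⊆ Metric.closedBall 0 1) (hε : 0 < ε)
    (hg : ContDiff ℝ ∞ g) (hgc : HasCompactSupport g) :
    Integrable (fun z : ℝ × Space N =>
      mollify Ω η ε (ρ z.1) z.2 * spaceDeriv g z.1 z.2 (u z.1 z.2)) (cylMeasure T Ω) := by
  have hfin := isFiniteMeasure_restrict_of_isBounded hΩ
  have h : Integrable (fun z : ℝ × Space N => mollify Ω η ε (ρ z.1) z.2 • u z.1 z.2)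
      (cylMeasure T Ω) := by
    refine (hb.integrable_mollify_integrand hη hηs hε).2.integral_prod_left.congr
      (Eventually.of_forall fun z => ?_)
    exact integral_smul_const (fun y => ρ z.1 y * kernel η ε (z.2 - y)) (u z.1 z.2)
  have hc : Continuous fun z : ℝ × Space N =>
      (fderiv ℝ g z).comp (ContinuousLinearMap.inr ℝ ℝ (Space N)) :=
    (hg.continuous_fderiv (by simp)).clm_comp continuous_const
  obtain ⟨C, hC⟩ := HasCompactSupport.exists_bound_of_continuous
    ((hgc.fderiv (𝕜 := ℝ)).comp_left (g := fun L : ℝ × Space N →L[ℝ] ℝ =>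
      L.comp (ContinuousLinearMap.inr ℝ ℝ (Space N))) (by simp)) hc
  refine (integrable_bdd_clm_apply hc.aestronglyMeasurable hC h).congr
    (Eventually.of_forall fun z => ?_)
  simp only [spaceDeriv_eq_fderiv hg, map_smul, smul_eq_mul]

theorem integrable_commutator_mul
    (hΩ : Bornology.IsBounded (Ω : Set (Space N)))
    (hb : HasIntegralBounds (volume.restrict (Ioo 0 T)) (volume.restrict (Ω : Set (Space N))) u ρ)
    (hη : ContDiff ℝ ∞ η) (hηs : tsupport η ⊆ Metric.closedBall 0 1) (hε : 0 < ε)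
    (hg : ContDiff ℝ ∞ g) (hgc : HasCompactSupport g) :
    Integrable (fun z : ℝ × Space N => commutator Ω η u ρ ε z.1 z.2 * g z) (cylMeasure T Ω) := by
  obtain ⟨C, hC⟩ := hgc.exists_bound_of_continuous hg.continuous
  exact (integrable_commutator hΩ hb hη hηs hε).mul_bdd (c := C)
    hg.continuous.aestronglyMeasurable (Eventually.of_forall hC)

theorem integrable_mollify_mul (hη : ContDiff ℝ ∞ η)
    (hηs : tsupport η ⊆ Metric.closedBall 0 1) (hε : 0 < ε)
    (hρ₀ : Integrable ρ₀ (volume.restrict (Ω : Set (Space N))))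
    (hg : ContDiff ℝ ∞ g) (hgc : HasCompactSupport g) (t : ℝ) :
    Integrable (fun x => mollify Ω η ε ρ₀ x * g (t, x)) volume :=
  ((contDiff_mollify hη hηs hε hρ₀).1.continuous.mul
    (contDiff_slice hg t).continuous).integrable_of_hasCompactSupport
    (hasCompactSupport_slice hgc t).mul_left

/-- The equation of the mollified density, tested with functions supported in the inner set. -/
theorem weakForm_mollify (hΩ : Bornology.IsBounded (Ω : Set (Space N)))
    (hb : HasIntegralBounds (volume.restrict (Ioo 0 T)) (volume.restrict (Ω : Set (Space N))) u ρ)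
    (hdiv : ∀ᵐ t ∂(volume.restrict (Ioo 0 T)), IsDivFree Ω (u t))
    (hρ₀ : Integrable ρ₀ (volume.restrict (Ω : Set (Space N))))
    (hsol : IsWeakSolution T Ω u ρ ρ₀)
    (hη : ContDiff ℝ ∞ η) (hηs : tsupport η ⊆ Metric.closedBall 0 1) (hε : 0 < ε)
    (hg : ContDiff ℝ ∞ g) (hgc : HasCompactSupport g)
    (hgs : tsupport g ⊆ Iio T ×ˢ innerSet (Ω : Set (Space N)) ε) :
    weakForm T Ω u (fun t => mollify Ω η ε (ρ t)) (mollify Ω η ε ρ₀) g =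
      ∫ t in Ioo 0 T, ∫ x in (Ω : Set (Space N)), commutator Ω η u ρ ε t x * g (t, x) := by
  have hfin := isFiniteMeasure_restrict_of_isBounded hΩ
  have hgΩ : ∀ t, tsupport (fun x => g (t, x)) ⊆ (Ω : Set (Space N)) := fun t x hx =>
    innerSet_subset _ _ (hgs (tsupport_slice_subset g t hx)).2
  have hg0 : ∀ t, ∀ x ∉ (Ω : Set (Space N)), g (t, x) = 0 := fun t x hx =>
    image_eq_zero_of_notMem_tsupport (f := fun x => g (t, x)) fun h => hx (hgΩ t h)
  have hgi : ∀ t, Integrable (fun x => g (t, x)) volume := fun t =>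
    (contDiff_slice hg t).continuous.integrable_of_hasCompactSupport (hasCompactSupport_slice hgc t)
  have hti : ∀ t, Integrable (timeDeriv g t) volume := fun t =>
    ((continuous_timeDeriv hg).comp (by fun_prop : Continuous fun x : Space N => (t, x))
      ).integrable_of_hasCompactSupport
      (hasCompactSupport_slice (g := fun z => timeDeriv g z.1 z.2)
        (hasCompactSupport_timeDeriv hg hgc) t)
  obtain ⟨hK, hKs⟩ := tsupport_dualMollify_slice_subset (η := η) hηs hε hgc
  -- The original equation is tested with the adjoint mollification of `g`. It is admissible because
  -- `ε`-balls around points of the inner set lie in `Ω`.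
  let Φ : 𝓓(timeSpace T Ω, ℝ) :=
    ⟨fun z => dualMollify η ε (fun x => g (z.1, x)) z.2, contDiff_dualMollify_slice hη hg hgc,
      hK.of_isClosed_subset (isClosed_tsupport _) hKs, by
        refine hKs.trans ?_
        rintro _ ⟨⟨⟨t, x⟩, w⟩, ⟨h1, h2⟩, rfl⟩
        refine ⟨(hgs h1).1, closedBall_subset_of_mem_innerSet Ω.isOpen hε.le (hgs h1).2 ?_⟩
        simpa [dist_eq_norm] using h2⟩
  have hΦt : ∀ t y, timeDeriv Φ t y = dualMollify η ε (timeDeriv g t) y :=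
    timeDeriv_dualMollify_slice hη hηs hε hg hgc
  have h := hsol Φ
  have e1 : ∫ t in Ioo 0 T, ∫ x in (Ω : Set (Space N)), ρ t x * timeDeriv Φ t x =
      ∫ t in Ioo 0 T, ∫ x in (Ω : Set (Space N)), mollify Ω η ε (ρ t) x * timeDeriv g t x := by
    refine integral_congr_ae ?_
    filter_upwards [hb.ae_integrable] with t ht
    simp only [hΦt]
    exact integral_mul_dualMollify hη hηs hε ht.1 (hti t)
      fun x hx => timeDeriv_eq_zero fun s => hg0 s x hx
  have e2 : ∫ x in (Ω : Set (Space N)), ρ₀ x * Φ (0, x) =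
      ∫ x in (Ω : Set (Space N)), mollify Ω η ε ρ₀ x * g (0, x) :=
    integral_mul_dualMollify hη hηs hε hρ₀ (hgi 0) (hg0 0)
  have e3 : ∫ t in Ioo 0 T, ∫ x in (Ω : Set (Space N)), ρ t x * spaceDeriv Φ t x (u t x) =
      (∫ t in Ioo 0 T, ∫ x in (Ω : Set (Space N)),
        mollify Ω η ε (ρ t) x * spaceDeriv g t x (u t x)) -
      ∫ t in Ioo 0 T, ∫ x in (Ω : Set (Space N)), commutator Ω η u ρ ε t x * g (t, x) := by
    have i1 : Integrable (fun t => ∫ x in (Ω : Set (Space N)),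
        mollify Ω η ε (ρ t) x * spaceDeriv g t x (u t x)) (volume.restrict (Ioo 0 T)) :=
      (integrable_mollify_mul_spaceDeriv hΩ hb hη hηs hε hg hgc).integral_prod_left
    have i2 : Integrable (fun t => ∫ x in (Ω : Set (Space N)),
        commutator Ω η u ρ ε t x * g (t, x)) (volume.restrict (Ioo 0 T)) :=
      (integrable_commutator_mul hΩ hb hη hηs hε hg hgc).integral_prod_left
    rw [← integral_sub i1 i2]
    refine integral_congr_ae ?_
    filter_upwards [hb.ae_integrable, hdiv] with t ht hdt
    exact integral_mul_fderiv_dualMollify hη hηs hε ht.1 ht.2.1 ht.2.2 hdt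
      (contDiff_slice hg t) (hasCompactSupport_slice hgc t) (hgΩ t)
  rw [weakForm, e1, e2, e3] at h
  rw [weakForm]
  linarith

end Mollified

end

/-! ### Reduction of general test functions to those supported in the inner set. -/

section

variable {N : ℕ}

/-- For negative times `φ` may be nonzero outside `Ω₀`. Multiplying by a spatial cutoff equal to 1
on `Ω₀` corrects this and changes nothing on `[0,T)`. -/
theorem exists_contDiff_eq_tsupport_subset {T : ℝ} {Ω : Opens (Space N)} {U : Set (Space N)}
    (φ : 𝓓(timeSpace T Ω, ℝ)) {Ω₀ : Set (Space N)} (hΩ₀ : IsCompact Ω₀)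
    (hφ : ∀ t ∈ Ico 0 T, ∀ x ∉ Ω₀, φ (t, x) = 0) (hU : IsOpen U) (hU' : Ω₀ ⊆ U) :
    ∃ g : ℝ × Space N → ℝ, ContDiff ℝ ∞ g ∧ HasCompactSupport g ∧ tsupport g ⊆ Iio T ×ˢ U ∧
      ∀ t ∈ Ico 0 T, ∀ x, φ (t, x) = g (t, x) := by
  obtain ⟨χ, hχ, hχ1, hχs⟩ := exists_contDiff_eq_one_tsupport_subset hΩ₀ hU hU'
  refine ⟨fun z => χ z.2 * φ z, (hχ.comp contDiff_snd).mul φ.contDiff,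
    φ.hasCompactSupport.mul_left, fun z hz => ⟨?_, ?_⟩, fun t ht x => ?_⟩
  · exact (φ.tsupport_subset (tsupport_mul_subset_right hz)).1
  · refine hχs ?_
    have h : tsupport (fun z : ℝ × Space N => χ z.2) ⊆ Prod.snd ⁻¹' tsupport χ :=
      closure_minimal (fun _ hx => subset_tsupport χ hx)
        ((isClosed_tsupport χ).preimage continuous_snd)
    exact h (tsupport_mul_subset_left hz)
  · by_cases hx : x ∈ Ω₀
    · simp [hχ1 x hx]
    · simp [hφ t ht x hx]

section

variable {T : ℝ} {Ω : Opens (Space N)} {u : ℝ → Space N → Space N} {ρ : ℝ → Space N → ℝ}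
  {ρ₀ : Space N → ℝ} {η : Space N → ℝ} {ε : ℝ}

/-- The equation of the mollified density. -/
theorem weakForm_mollify_test (hT : 0 < T) (hΩ : Bornology.IsBounded (Ω : Set (Space N)))
    (hb : HasIntegralBounds (volume.restrict (Ioo 0 T)) (volume.restrict (Ω : Set (Space N))) u ρ)
    (hdiv : ∀ᵐ t ∂(volume.restrict (Ioo 0 T)), IsDivFree Ω (u t))
    (hρ₀ : Integrable ρ₀ (volume.restrict (Ω : Set (Space N))))
    (hsol : IsWeakSolution T Ω u ρ ρ₀)
    (hη : ContDiff ℝ ∞ η) (hηs : tsupport η ⊆ Metric.closedBall 0 1)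
    (φ : 𝓓(timeSpace T Ω, ℝ)) {Ω₀ : Set (Space N)} (hΩ₀ : IsCompact Ω₀) (hΩ₀' : Ω₀ ⊆ Ω)
    (hφ : ∀ t ∈ Ico 0 T, ∀ x ∉ Ω₀, φ (t, x) = 0) (hε : 0 < ε)
    (hε' : ENNReal.ofReal ε < setDist Ω₀ (frontier (Ω : Set (Space N)))) :
    Integrable (fun z : ℝ × Space N => mollify Ω η ε (ρ z.1) z.2 * timeDeriv φ z.1 z.2)
      (cylMeasure T (innerSet Ω ε)) ∧
    Integrable (fun x => mollify Ω η ε ρ₀ x * φ (0, x)) (volume.restrict (innerSet Ω ε)) ∧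
    Integrable (fun z : ℝ × Space N =>
      mollify Ω η ε (ρ z.1) z.2 * spaceDeriv φ z.1 z.2 (u z.1 z.2))
      (cylMeasure T (innerSet Ω ε)) ∧
    Integrable (fun z : ℝ × Space N => commutator Ω η u ρ ε z.1 z.2 * φ z) (cylMeasure T Ω) ∧
    weakForm T (innerSet Ω ε) u (fun t => mollify Ω η ε (ρ t)) (mollify Ω η ε ρ₀) φ =
      ∫ t in Ioo 0 T, ∫ x in (Ω : Set (Space N)), commutator Ω η u ρ ε t x * φ (t, x) := by
  obtain ⟨g, hg, hgc, hgs, hφg⟩ := exists_contDiff_eq_tsupport_subset φ hΩ₀ hφ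
    (isOpen_innerSet Ω.isOpen ε) (subset_innerSet hΩ₀' hε')
  have hle := cylMeasure_mono (T := T) (innerSet_subset (Ω : Set (Space N)) ε)
  refine ⟨?_, ?_, ?_, ?_, ?_⟩
  · refine ((integrable_mollify_mul_timeDeriv hΩ hb hη hηs hε hg hgc).mono_measure hle).congr ?_
    filter_upwards [ae_cylMeasure_mem_Ioo T _] with z hz
    rw [timeDeriv_congr hφg hz]
  · simpa only [hφg 0 ⟨le_rfl, hT⟩] using
      (integrable_mollify_mul hη hηs hε hρ₀ hg hgc 0).restrict
  · refine ((integrable_mollify_mul_spaceDeriv hΩ hb hη hηs hε hg hgc).mono_measure hle).congr ?_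
    filter_upwards [ae_cylMeasure_mem_Ioo T _] with z hz
    rw [spaceDeriv_congr hφg hz]
  · refine (integrable_commutator_mul hΩ hb hη hηs hε hg hgc).congr ?_
    filter_upwards [ae_cylMeasure_mem_Ioo T _] with z hz
    rw [← hφg z.1 (Ioo_subset_Ico_self hz) z.2]
  -- The weak form sees only times in `[0,T)`, so `φ` can be replaced by `g`; as `g` is supported
  -- over the inner set, the domain can then be enlarged to `Ω`.
  · rw [weakForm_congr hT hφg, weakForm_mono_set Ω.isOpen.measurableSet (innerSet_subset _ ε)
      (hgs.trans (prod_mono (subset_univ _) le_rfl)),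
      weakForm_mollify hΩ hb hdiv hρ₀ hsol hη hηs hε hg hgc hgs]
    refine setIntegral_congr_fun measurableSet_Ioo fun t ht => ?_
    simp only [hφg t (Ioo_subset_Ico_self ht)]

end

end

end Transport

end

theorem mainTheorem8 {N : ℕ} (T : ℝ) (hT : 0 < T)
    (Ω : Opens (Transport.Space N)) (hΩ : Bornology.IsBounded (Ω : Set (Transport.Space N)))
    (p q α : ℝ≥0∞) (hp : 1 < p) (hpq : p⁻¹ + q⁻¹ = 1) (hα : q ≤ α)
    (u : ℝ → Transport.Space N → Transport.Space N) (hu : Transport.MemL1W1 T Ω α u)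
    (hdiv : ∀ᵐ t ∂(volume.restrict (Ioo 0 T)), Transport.IsDivFree Ω (u t))
    (ρ₀ : Transport.Space N → ℝ)
    (hρ₀ : MemLp ρ₀ p (volume.restrict (Ω : Set (Transport.Space N))))
    (ρ : ℝ → Transport.Space N → ℝ) (hρ : Transport.MemLinftyLp T Ω p ρ)
    (hsol : Transport.IsWeakSolution T Ω u ρ ρ₀)
    (η : Transport.Space N → ℝ) (hη : ContDiff ℝ ∞ η) (hη0 : ∀ x, 0 ≤ η x)
    (hηsupp : tsupport η ⊆ Metric.closedBall 0 1) :
    -- the weak equation for the mollified density, with all its integrands integrable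
    (∀ (φ : 𝓓(Transport.timeSpace T Ω, ℝ)) (Ω₀ : Set (Transport.Space N)),
      IsCompact Ω₀ → Ω₀ ⊆ Ω → (∀ t ∈ Ico 0 T, ∀ x ∉ Ω₀, φ (t, x) = 0) →
      ∀ ε : ℝ, 0 < ε →
        ENNReal.ofReal ε < Transport.setDist Ω₀ (frontier (Ω : Set (Transport.Space N))) →
        Integrable (fun z : ℝ × Transport.Space N =>
            Transport.mollify Ω η ε (ρ z.1) z.2 * Transport.timeDeriv φ z.1 z.2)
          (Transport.cylMeasure T (Transport.innerSet Ω ε)) ∧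
        Integrable (fun x => Transport.mollify Ω η ε ρ₀ x * φ (0, x))
          (volume.restrict (Transport.innerSet Ω ε)) ∧
        Integrable (fun z : ℝ × Transport.Space N =>
            Transport.mollify Ω η ε (ρ z.1) z.2 *
              Transport.spaceDeriv φ z.1 z.2 (u z.1 z.2))
          (Transport.cylMeasure T (Transport.innerSet Ω ε)) ∧
        Integrable (fun z : ℝ × Transport.Space N =>
            Transport.commutator Ω η u ρ ε z.1 z.2 * φ z)
          (Transport.cylMeasure T Ω) ∧
        Transport.weakForm T (Transport.innerSet Ω ε) u
            (fun t => Transport.mollify Ω η ε (ρ t)) (Transport.mollify Ω η ε ρ₀) φ =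
          ∫ t in Ioo 0 T, ∫ x in (Ω : Set (Transport.Space N)),
            Transport.commutator Ω η u ρ ε t x * φ (t, x)) ∧
    -- the error is measurable and tends to zero
    (∀ ε : ℝ, 0 < ε →
      AEStronglyMeasurable (Function.uncurry (Transport.commutator Ω η u ρ ε))
        (Transport.cylMeasure T Ω)) ∧
    (∀ γ : ℝ≥0∞, 1 ≤ γ → γ ≠ ⊤ → (γ⁻¹ = α⁻¹ + p⁻¹ ∨ (α = ⊤ ∧ p = ⊤)) →
      ∀ Ω₀ : Set (Transport.Space N), Ω₀ ⊆ Ω →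
        (IsCompact Ω₀ ∨ Transport.HasSmoothBoundary (Ω : Set (Transport.Space N))) →
        Tendsto (fun ε : ℝ => ∫⁻ t in Ioo 0 T,
            eLpNorm (Transport.commutator Ω η u ρ ε t) γ (volume.restrict Ω₀))
          (𝓝[>] 0) (𝓝 0)) := by
  have hb := Transport.hasIntegralBounds hΩ hp hpq hα hu hρ
  have hfin := Transport.isFiniteMeasure_restrict_of_isBounded hΩ
  have hm : ∀ ε : ℝ, 0 < ε → AEStronglyMeasurable
      (Function.uncurry (Transport.commutator Ω η u ρ ε)) (Transport.cylMeasure T Ω) :=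
    fun ε hε => (Transport.integrable_commutator hΩ hb hη hηsupp hε).aestronglyMeasurable
  exact ⟨fun φ Ω₀ hΩ₀ hΩ₀' hφ ε hε hε' =>
      Transport.weakForm_mollify_test hT hΩ hb hdiv (hρ₀.integrable hp.le) hsol hη hηsupp φ
        hΩ₀ hΩ₀' hφ hε hε',
    hm, fun γ hγ hγ' hγα Ω₀ hΩ₀ h =>
      Transport.tendsto_lintegral_commutator hΩ hp ((Transport.one_le_of_conjugate hpq).trans hα)
        hu hdiv hρ hη hηsupp hm hγ hγ' hγα hΩ₀ h⟩
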